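/- Fix an integer $r\ge 2$ and write $\zeta_{2r}^x=e^{\pi\sqrt{-1}\,x/r}$ for $x\in\mathbb C$. For $\alpha\in\mathbb C$ let $V_\alpha$ be the $r$-dimensional highest weight module, with basis $v_0,\dots,v_{r-1}$, of the unrolled restricted quantum group $\overline U{}^H_{\zeta_{2r}}(\mathfrak{sl}_2)$: $$Hv_i=(\alpha-2i)v_i,\quad Kv_i=\zeta_{2r}^{\alpha-2i}v_i,\quad Ev_i=\tfrac{\zeta_{2r}^{\alpha-i+1}-\zeta_{2r}^{-(\alpha-i+1)}}{\zeta_{2r}-\zeta_{2r}^{-1}}v_{i-1},\quad Fv_i=\tfrac{\zeta_{2r}^{i+1}-\zeta_{2r}^{-(i+1)}}{\zeta_{2r}-\zeta_{2r}^{-1}}v_{i+1}\qquad(v_{-1}=v_r=0).$$ Let $L$ be a framed oriented link in $S^3$ with $n\geq 1$ components, coloured by $V_{\alpha_1},\dots,V_{\alpha_n}$. Cut $L$ open along any one component $c$ to a $(1,1)$-tangle $T$, given by any diagram whose blackboard framing is the framing of $L$ and all of whose crossings have both strands oriented downwards. Let $F(T)\in\operatorname{End}(V_{\alpha_c})$ be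 the value of the Reshetikhin-Turaev functor, in which positive crossings are sent to the braiding $\tau\circ R$ and negative crossings to the inverse braiding $R^{-1}\circ\tau$, where $\tau$ is the flip and $$R=\zeta_{2r}^{H\otimes H/2}\sum_{k=0}^{r-1}\frac{(\zeta_{2r}-\zeta_{2r}^{-1})^{2k}}{\zeta_{2r}^k\,(\zeta_{2r}^{-2};\zeta_{2r}^{-2})_k}E^k\otimes F^k ,\qquad (x;p)_k=\prod_{m=0}^{k-1}(1-xp^m),$$ and the cups and caps are sent to $1\mapsto\sum v_i\otimes v_i^*$, $1\mapsto \sum v_i^*\otimes K^{r-1}v_i$, $f\otimes v\mapsto f(v)$, $v\otimes f\mapsto f(K^{1-r}v)$. For $\alpha\in(\mathbb C\setminus\mathbb Z)^n$ one has $F(T)=\langle T\rangle\,\mathrm{Id}$ for a scalar $\langle T\rangle$, and the ADO invariant $N_L^r:(\mathbb C\setminus\mathbb Z)^n\to\mathbb C$ is $$N_L^r(\alpha_1,\dots,\alpha_n)=\langle T\rangle\prod_{j=0}^{r-2}\frac{1}{\zeta_{2r}^{\alpha_c+r-j}-\zeta_{2r}^{-(\alpha_c+r-j)}} .$$ Let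 $C=(C_{ij})$ be the linking matrix of $L$, with $C_{ii}$ the framing of the $i$-th component. Then: (i) If $n=1$, $N_L^r$ extends to a meromorphic function on $\mathbb C$ that is holomorphic on $\mathbb C\setminus\mathbb Z$ and has at most a simple pole at each integer. (ii) If $n>1$, $N_L^r$ extends to a holomorphic function on $\mathbb C^n$. (iii) For every $n$, every $i$ and every $\alpha\in(\mathbb C\setminus\mathbb Z)^n$, $$N_L^r(\alpha_1,\dots,\alpha_i+2r,\dots,\alpha_n)=\Big(\prod_{j=1}^n\zeta_{2r}^{2rC_{ij}\alpha_j}\Big)N_L^r(\alpha_1,\dots,\alpha_n).$$ Consequently $N_L^r$ is a section, holomorphic if $n>1$ and meromorphic if $n=1$, of the complex line bundle on $(\mathbb C/2r\mathbb Z)^n$ determined by $C$, namely the quotient of $\mathbb C^n\times\mathbb C$ by the action $m\cdot(\alpha,v)=\big(\alpha+2rm,\ \zeta_{2r}^{2r\sum_{i,j}m_iC_{ij}\alpha_j}v\big)$ of $\mathbb Z^n$. -/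

import Mathlib

noncomputable section

namespace ADO

/-! ### Oriented tangle diagrams

Diagrams are read from bottom to top and cut into elementary horizontal layers. The strands
crossing a horizontal line are listed from left to right. Every strand carries the index of the
link component to which it belongs. -/

/-- A strand crossing a horizontal line: its component and its orientation. -/
inductive Strand (n : ℕ) : Type
  | down (i : Fin n) : Strand n
  | up (i : Fin n) : Strand n

open Strand

/-- The component of a strand. -/
def Strand.comp {n : ℕ} : Strand n → Fin n
  | down i => i
  | up i => i

/-- An elementary layer of an oriented tangle diagram, from the list of strands below it to the
list of strands above it. It contains exactly one crossing (between two strands oriented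
downwards), cup or cap; all other strands are vertical.

* `pos i j w`: the positive crossing; the over-strand runs between bottom left and top right,
  and belongs to the component `i`.
* `neg i j w`: the negative crossing; the over-strand runs between bottom right and top left,
  and belongs to the component `j`.
* `cupR`, `cupL`: cups directed to the right and to the left.
* `capR`, `capL`: caps directed to the right and to the left.
* `skip x s`: the layer `s` with one more vertical strand `x` at its left.

The list `w` holds the vertical strands at the right. -/
inductive Layer (n : ℕ) : List (Strand n) → List (Strand n) → Type
  | pos (i j : Fin n) (w : List (Strand n)) :
      Layer n (down i :: down j :: w) (down j :: down i :: w)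
  | neg (i j : Fin n) (w : List (Strand n)) :
      Layer n (down i :: down j :: w) (down j :: down i :: w)
  | cupR (i : Fin n) (w : List (Strand n)) : Layer n w (down i :: up i :: w)
  | cupL (i : Fin n) (w : List (Strand n)) : Layer n w (up i :: down i :: w)
  | capR (i : Fin n) (w : List (Strand n)) : Layer n (up i :: down i :: w) w
  | capL (i : Fin n) (w : List (Strand n)) : Layer n (down i :: up i :: w) w
  | skip (x : Strand n) {v w : List (Strand n)} (s : Layer n v w) : Layer n (x :: v) (x :: w)

/-- A tangle diagram: a finite stack of layers, the lowest one first. -/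
inductive Diagram (n : ℕ) : List (Strand n) → List (Strand n) → Type
  | nil (v : List (Strand n)) : Diagram n v v
  | cons {u v w : List (Strand n)} (s : Layer n u v) (D : Diagram n v w) : Diagram n u w

/-! ### Components -/

/-- Two points on the boundary of a layer are joined by an arc inside the layer. The point
`Sum.inl p` is the `p`-th point from the left on the lower line, `Sum.inr p` the one on the upper
line. -/
inductive Layer.Joined {n : ℕ} :
    {v w : List (Strand n)} → Layer n v w → ℕ ⊕ ℕ → ℕ ⊕ ℕ → Prop
  | pos_left (i j w) : Joined (.pos i j w) (.inl 0) (.inr 1)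
  | pos_right (i j w) : Joined (.pos i j w) (.inl 1) (.inr 0)
  | pos_rest (i j w p) : Joined (.pos i j w) (.inl (p + 2)) (.inr (p + 2))
  | neg_left (i j w) : Joined (.neg i j w) (.inl 0) (.inr 1)
  | neg_right (i j w) : Joined (.neg i j w) (.inl 1) (.inr 0)
  | neg_rest (i j w p) : Joined (.neg i j w) (.inl (p + 2)) (.inr (p + 2))
  | cupR (i w) : Joined (.cupR i w) (.inr 0) (.inr 1)
  | cupR_rest (i w p) : Joined (.cupR i w) (.inl p) (.inr (p + 2))
  | cupL (i w) : Joined (.cupL i w) (.inr 0) (.inr 1)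
  | cupL_rest (i w p) : Joined (.cupL i w) (.inl p) (.inr (p + 2))
  | capR (i w) : Joined (.capR i w) (.inl 0) (.inl 1)
  | capR_rest (i w p) : Joined (.capR i w) (.inl (p + 2)) (.inr p)
  | capL (i w) : Joined (.capL i w) (.inl 0) (.inl 1)
  | capL_rest (i w p) : Joined (.capL i w) (.inl (p + 2)) (.inr p)
  | skip_left (x) {v w} (s : Layer n v w) : Joined (.skip x s) (.inl 0) (.inr 0)
  | skip_rest (x) {v w} (s : Layer n v w) {a b : ℕ ⊕ ℕ} (h : Joined s a b) :
      Joined (.skip x s) (a.map Nat.succ Nat.succ) (b.map Nat.succ Nat.succ)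

/-- The horizontal lines of a diagram, from bottom to top. -/
def Diagram.lines {n : ℕ} : {v w : List (Strand n)} → Diagram n v w → List (List (Strand n))
  | _, _, .nil v => [v]
  | _, _, .cons (u := u) _ D => u :: D.lines

/-- The component at the point `(k, p)` of a diagram, the `p`-th point from the left on the `k`-th
horizontal line; `none` if there is no such point. -/
def Diagram.compAt {n : ℕ} {v w : List (Strand n)} (D : Diagram n v w) (x : ℕ × ℕ) :
    Option (Fin n) :=
  ((D.lines[x.1]?).bind fun l => l[x.2]?).map Strand.comp

/-- Two points of a diagram are joined by an arc inside one layer. -/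
inductive Diagram.Joined {n : ℕ} :
    {v w : List (Strand n)} → Diagram n v w → ℕ × ℕ → ℕ × ℕ → Prop
  | head {u v w : List (Strand n)} (s : Layer n u v) (D : Diagram n v w) {a b : ℕ ⊕ ℕ}
      (h : s.Joined a b) :
      Joined (.cons s D) (a.elim (Prod.mk 0) (Prod.mk 1)) (b.elim (Prod.mk 0) (Prod.mk 1))
  | tail {u v w : List (Strand n)} (s : Layer n u v) (D : Diagram n v w) {k l p q : ℕ}
      (h : Joined D (k, p) (l, q)) : Joined (.cons s D) (k + 1, p) (l + 1, q)

/-- The indices in `Fin n` number the connected components of the curve drawn by the diagram: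
each index occurs, and points with the same index are connected along the curve. (Connected points
always have the same index.) -/
def Diagram.NumbersComponents {n : ℕ} {v w : List (Strand n)} (D : Diagram n v w) : Prop :=
  (∀ i, ∃ x, D.compAt x = some i) ∧
    ∀ i x y, D.compAt x = some i → D.compAt y = some i → Relation.EqvGen D.Joined x y

/-! ### The linking matrix -/

/-- The signed number of crossings of a layer at which `i` passes over `j`. -/
def Layer.over {n : ℕ} : {v w : List (Strand n)} → Layer n v w → Fin n → Fin n → ℤ
  | _, _, .pos a b _, i, j => if i = a ∧ j = b then 1 else 0
  | _, _, .neg a b _, i, j => if i = b ∧ j = a then -1 else 0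
  | _, _, .skip _ s, i, j => s.over i j
  | _, _, .cupR _ _, _, _ => 0
  | _, _, .cupL _ _, _, _ => 0
  | _, _, .capR _ _, _, _ => 0
  | _, _, .capL _ _, _, _ => 0

/-- The linking matrix of a diagram. The entry `(i, j)` is the signed number of crossings at which
the component `i` passes over the component `j`. For `i ≠ j` this is the linking number (see
`linking_comm`); the entry `(i, i)` is the writhe of the component `i`, that is, its framing when
the link carries the blackboard framing. -/
def Diagram.linking {n : ℕ} : {v w : List (Strand n)} → Diagram n v w → Matrix (Fin n) (Fin n) ℤ
  | _, _, .nil _ => 0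
  | _, _, .cons s D => Matrix.of s.over + D.linking

/-- The algebraic number of strands of the component `i` on a horizontal line. -/
def Strand.sign {n : ℕ} (i : Fin n) : Strand n → ℤ
  | down a => if i = a then 1 else 0
  | up a => if i = a then -1 else 0

/-- The algebraic number of pairs on a horizontal line with `i` to the left of `j`. -/
def pairs {n : ℕ} (i j : Fin n) : List (Strand n) → ℤ
  | [] => 0
  | x :: w => x.sign i * (w.map (Strand.sign j)).sum + pairs i j w

theorem Layer.sum_sign {n : ℕ} (j : Fin n) {v w : List (Strand n)} (s : Layer n v w) :
    (v.map (Strand.sign j)).sum = (w.map (Strand.sign j)).sum := by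
  induction s with
  | skip x s ih => simp [ih]
  | _ => simp only [List.map_cons, List.sum_cons, Strand.sign]; split_ifs <;> ring

theorem Layer.pairs_eq {n : ℕ} {i j : Fin n} (hij : i ≠ j) {v w : List (Strand n)}
    (s : Layer n v w) : pairs i j v = pairs i j w + (s.over i j - s.over j i) := by
  induction s with
  | skip x s ih => simp only [pairs, Layer.over, ih, s.sum_sign j]; ring
  | _ => simp only [pairs, Layer.over, Strand.sign, List.map_cons, List.sum_cons]
         grind

theorem Diagram.pairs_eq {n : ℕ} {i j : Fin n} (hij : i ≠ j) {v w : List (Strand n)}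
    (D : Diagram n v w) : pairs i j v = pairs i j w + (D.linking i j - D.linking j i) := by
  induction D with
  | nil v => simp [Diagram.linking]
  | cons s D ih =>
    rw [s.pairs_eq hij, ih]
    simp only [Diagram.linking, Matrix.add_apply, Matrix.of_apply]
    ring

/-- The linking matrix of a diagram of a (1,1)-tangle is symmetric. -/
theorem Diagram.linking_comm {n : ℕ} {c : Fin n} (T : Diagram n [down c] [down c]) (i j : Fin n) :
    T.linking i j = T.linking j i := by
  rcases eq_or_ne i j with rfl | hij
  · rfl
  · have := T.pairs_eq hij
    linarith

/-! ### The modules `V_α` and the ribbon structure -/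

/-- `ζ_{2r}^x = exp (π √-1 x / r)`. -/
def zeta (r : ℕ) (x : ℂ) : ℂ := Complex.exp (Real.pi * Complex.I / r * x)

/-- The weight `α - 2 i` of the basis vector `v_i` of `V_α`. -/
def weight {r : ℕ} (α : ℂ) (i : Fin r) : ℂ := α - 2 * (i : ℕ)

/-- The action of `E` on `V_α` in the basis `v_0, …, v_{r-1}`. -/
def opE (r : ℕ) (α : ℂ) : Matrix (Fin r) (Fin r) ℂ := Matrix.of fun k i =>
  if (k : ℕ) + 1 = i then
    (zeta r (α - (i : ℕ) + 1) - zeta r (-(α - (i : ℕ) + 1))) / (zeta r 1 - zeta r (-1))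
  else 0

/-- The action of `F` on `V_α` in the basis `v_0, …, v_{r-1}`; it does not depend on `α`. -/
def opF (r : ℕ) : Matrix (Fin r) (Fin r) ℂ := Matrix.of fun k i =>
  if (k : ℕ) = i + 1 then
    (zeta r ((i : ℕ) + 1) - zeta r (-((i : ℕ) + 1))) / (zeta r 1 - zeta r (-1))
  else 0

/-- The `q`-Pochhammer symbol `(x; p)_k`. -/
def qPochhammer (x p : ℂ) (k : ℕ) : ℂ := ∏ m ∈ Finset.range k, (1 - x * p ^ m)

/-- The operator `ζ_{2r}^{s H ⊗ H / 2}` on `V_α ⊗ V_β`. -/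
def opHH (r : ℕ) (s α β : ℂ) : Matrix (Fin r × Fin r) (Fin r × Fin r) ℂ :=
  Matrix.diagonal fun p => zeta r (s * (weight α p.1 * weight β p.2 / 2))

open scoped Kronecker in
/-- The truncated `R`-matrix on `V_α ⊗ V_β`. -/
def opR (r : ℕ) (α β : ℂ) : Matrix (Fin r × Fin r) (Fin r × Fin r) ℂ :=
  opHH r 1 α β * ∑ k ∈ Finset.range r,
    ((zeta r 1 - zeta r (-1)) ^ (2 * k) /
      (zeta r k * qPochhammer (zeta r (-2)) (zeta r (-2)) k)) • ((opE r α ^ k) ⊗ₖ (opF r ^ k))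

open scoped Kronecker in
/-- The inverse of the truncated `R`-matrix on `V_α ⊗ V_β`. -/
def opRInv (r : ℕ) (α β : ℂ) : Matrix (Fin r × Fin r) (Fin r × Fin r) ℂ :=
  (∑ k ∈ Finset.range r,
    ((-1) ^ k * (zeta r 1 - zeta r (-1)) ^ (2 * k) /
      (zeta r ((k : ℂ) ^ 2) * qPochhammer (zeta r (-2)) (zeta r (-2)) k)) •
        ((opE r α ^ k) ⊗ₖ (opF r ^ k))) * opHH r (-1) α β

/-- The braiding `τ ∘ R : V_α ⊗ V_β → V_β ⊗ V_α`. -/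
def braiding (r : ℕ) (α β : ℂ) : Matrix (Fin r × Fin r) (Fin r × Fin r) ℂ :=
  (opR r α β).submatrix Prod.swap id

/-- The inverse braiding `R⁻¹ ∘ τ : V_α ⊗ V_β → V_β ⊗ V_α`, the inverse of
`τ ∘ R : V_β ⊗ V_α → V_α ⊗ V_β`. -/
def braidingInv (r : ℕ) (α β : ℂ) : Matrix (Fin r × Fin r) (Fin r × Fin r) ℂ :=
  (opRInv r β α).submatrix id Prod.swap

/-- The eigenvalue of `K ^ s` at the basis vector `v_i` of `V_α`. -/
def eigK (r : ℕ) (α s : ℂ) (i : Fin r) : ℂ := zeta r (s * weight α i)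

/-! ### The Reshetikhin-Turaev functor -/

/-- The index set of the standard basis of the tensor product attached to a list of strands: the
module `V_{α_i}` for a strand `down i`, with the basis `v_a`, and its dual for a strand `up i`,
with the dual basis. -/
def State {n : ℕ} (r : ℕ) : List (Strand n) → Type
  | [] => Unit
  | _ :: w => Fin r × State r w

instance State.instFintype {n r : ℕ} : (w : List (Strand n)) → Fintype (State r w)
  | [] => inferInstanceAs (Fintype Unit)
  | _ :: w =>
    haveI := State.instFintype (r := r) w
    inferInstanceAs (Fintype (Fin r × State r w))

instance State.instDecidableEq {n r : ℕ} : (w : List (Strand n)) → DecidableEq (State r w)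
  | [] => inferInstanceAs (DecidableEq Unit)
  | _ :: w =>
    haveI := State.instDecidableEq (r := r) w
    inferInstanceAs (DecidableEq (Fin r × State r w))

/-- The matrix of the linear map attached to a layer, when the component `i` is coloured by
`V_{α_i}`. The row index is the state above the layer, the column index the one below. The four
maps at cups and caps are

* `1 ↦ ∑ v_a ⊗ v_a^*` and `1 ↦ ∑ v_a^* ⊗ K^{r-1} v_a`,
* `f ⊗ v ↦ f v` and `v ⊗ f ↦ f (K^{1-r} v)`. -/
def Layer.matrix {n : ℕ} (r : ℕ) (α : Fin n → ℂ) :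
    {v w : List (Strand n)} → Layer n v w → Matrix (State r w) (State r v) ℂ
  | _, _, .pos i j _ => Matrix.of fun (b', a', t) (a, b, s) =>
      if t = s then braiding r (α i) (α j) (b', a') (a, b) else 0
  | _, _, .neg i j _ => Matrix.of fun (b', a', t) (a, b, s) =>
      if t = s then braidingInv r (α i) (α j) (b', a') (a, b) else 0
  | _, _, .cupR _ _ => Matrix.of fun (a, b, t) s => if t = s ∧ a = b then 1 else 0
  | _, _, .cupL i _ => Matrix.of fun (a, b, t) s =>
      if t = s ∧ a = b then eigK r (α i) (r - 1) b else 0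
  | _, _, .capR _ _ => Matrix.of fun t (a, b, s) => if t = s ∧ a = b then 1 else 0
  | _, _, .capL i _ => Matrix.of fun t (a, b, s) =>
      if t = s ∧ a = b then eigK r (α i) (1 - r) a else 0
  | _, _, .skip _ s => Matrix.of fun (a', t') (a, t) => if a' = a then s.matrix r α t' t else 0

/-- The linear map `F(D)` attached to a diagram, as a matrix. -/
def Diagram.matrix {n : ℕ} (r : ℕ) (α : Fin n → ℂ) :
    {v w : List (Strand n)} → Diagram n v w → Matrix (State r w) (State r v) ℂ
  | _, _, .nil _ => 1
  | _, _, .cons s D => D.matrix r α * s.matrix r α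

/-! ### The ADO invariant -/

open Classical in
/-- The scalar `⟨T⟩` of a (1,1)-tangle, with `F(T) = ⟨T⟩ • Id`. -/
def Diagram.bracket {n : ℕ} (r : ℕ) {c : Fin n} (T : Diagram n [down c] [down c])
    (α : Fin n → ℂ) : ℂ :=
  if h : ∃ z : ℂ, T.matrix r α = z • 1 then h.choose else 0

/-- The modified dimension of `V_α`. -/
def modifiedDim (r : ℕ) (α : ℂ) : ℂ :=
  ∏ j ∈ Finset.range (r - 1), 1 / (zeta r (α + r - j) - zeta r (-(α + r - j)))

/-- The ADO invariant `N_L^r (α_1, …, α_n)` of the framed oriented link `L` obtained as the closure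
of the (1,1)-tangle `T`, whose open component is `c`. -/
def Diagram.invariant {n : ℕ} (r : ℕ) {c : Fin n} (T : Diagram n [down c] [down c])
    (α : Fin n → ℂ) : ℂ :=
  modifiedDim r (α c) * T.bracket r α

/-- The integers, as a subset of `ℂ`. -/
def integers : Set ℂ := Set.range ((↑) : ℤ → ℂ)

/-! ### The line bundle of an integral matrix -/

/-- The complex manifold `(ℂ / 2rℤ)^n`. -/
abbrev Base (r n : ℕ) : Type := Fin n → AddCircle (2 * (r : ℂ))

/-- The covering `ℂ^n → (ℂ / 2rℤ)^n`. -/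
def cover (r n : ℕ) (α : Fin n → ℂ) : Base r n := fun i => (α i : AddCircle (2 * (r : ℂ)))

theorem cover_surjective (r n : ℕ) : Function.Surjective (cover r n) := fun x =>
  ⟨fun i => (x i).out, funext fun i => Quotient.out_eq' (x i)⟩

theorem cover_isLocalHomeomorph (r n : ℕ) : IsLocalHomeomorph (cover r n) := by
  have h := AddCircle.isLocalHomeomorph_coe (2 * (r : ℂ))
  refine IsLocalHomeomorph.mk _ fun α => ?_
  choose e he using fun i => h (α i)
  refine ⟨OpenPartialHomeomorph.pi e, fun i _ => (he i).1, fun β _ => ?_⟩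
  funext i
  exact congrFun (he i).2 (β i)

theorem exists_int_of_cover_eq {r n : ℕ} {α β : Fin n → ℂ} (h : cover r n α = cover r n β) :
    ∃ m : Fin n → ℤ, ∀ i, β i - α i = m i * (2 * (r : ℂ)) := by
  choose m hm using fun i => AddSubgroup.mem_zmultiples_iff.1
    (QuotientAddGroup.eq.1 (congrFun h i))
  exact ⟨m, fun i => by rw [← zsmul_eq_mul, hm i]; ring⟩

/-- A chart of `(ℂ / 2rℤ)^n` near the image of `p`: a local inverse of the covering. -/
def chart {r n : ℕ} (p : Fin n → ℂ) : OpenPartialHomeomorph (Base r n) (Fin n → ℂ) :=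
  (cover_isLocalHomeomorph r n).localInverseAt p

/-- The factor `ζ_{2r}^{∑_{ij} (β_i - α_i) C_{ij} α_j}` by which a quasi-periodic function changes
from `α` to a point `β` over the same point of `(ℂ / 2rℤ)^n`. -/
def factor (r : ℕ) {n : ℕ} (C : Matrix (Fin n) (Fin n) ℤ) (α β : Fin n → ℂ) : ℂ :=
  zeta r (∑ i, ∑ j, (β i - α i) * C i j * α j)

theorem factor_self (r : ℕ) {n : ℕ} (C : Matrix (Fin n) (Fin n) ℤ) (α : Fin n → ℂ) :
    factor r C α α = 1 := by
  simp [factor, zeta]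

theorem factor_mul (r : ℕ) {n : ℕ} (C : Matrix (Fin n) (Fin n) ℤ) {α β γ : Fin n → ℂ}
    (h₁ : cover r n α = cover r n β) (h₂ : cover r n β = cover r n γ) :
    factor r C β γ * factor r C α β = factor r C α γ := by
  obtain ⟨a, ha⟩ := exists_int_of_cover_eq h₁
  obtain ⟨b, hb⟩ := exists_int_of_cover_eq h₂
  have e : (∑ i, ∑ j, (γ i - β i) * C i j * β j) + (∑ i, ∑ j, (β i - α i) * C i j * α j)
      = (∑ i, ∑ j, (γ i - α i) * C i j * α j)
        + ((∑ i, ∑ j, b i * C i j * a j : ℤ) : ℂ) * (4 * (r : ℂ) ^ 2) := by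
    push_cast
    simp only [Finset.sum_mul, ← Finset.sum_add_distrib]
    refine Finset.sum_congr rfl fun i _ => Finset.sum_congr rfl fun j _ => ?_
    have h1 : γ i = β i + b i * (2 * (r : ℂ)) := by linear_combination hb i
    have h2 : β j = α j + a j * (2 * (r : ℂ)) := by linear_combination ha j
    rw [h1, h2]
    ring
  rw [factor, factor, factor, zeta, zeta, zeta, ← Complex.exp_add, ← mul_add, e, mul_add,
    Complex.exp_add]
  set k : ℤ := ∑ i, ∑ j, b i * C i j * a j
  have : (Real.pi * Complex.I / r * ((k : ℂ) * (4 * (r : ℂ) ^ 2)))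
      = ((k * (2 * r) : ℤ) : ℂ) * (2 * Real.pi * Complex.I) := by
    rcases eq_or_ne (r : ℂ) 0 with h | h
    · simp [h]
    · push_cast
      field_simp
      ring
  rw [this, Complex.exp_int_mul_two_pi_mul_I, mul_one]

/-- The complex line bundle on `(ℂ / 2rℤ)^n` determined by the integral matrix `C`. It has one local
trivialization for each point `p` of `ℂ^n`, over the domain of the chart at `p`; in terms of the
points `α`, `β` of two such charts over the same point of the base, the change of coordinates is
multiplication by `ζ_{2r}^{∑_{ij} (β_i - α_i) C_{ij} α_j}`. In other words, it is the quotient of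
`ℂ^n × ℂ` by the action `m • (α, v) = (α + 2 r m, ζ_{2r}^{2r ∑_{ij} m_i C_{ij} α_j} v)` of
`ℤ^n`. -/
def lineBundle (r : ℕ) {n : ℕ} (C : Matrix (Fin n) (Fin n) ℤ) :
    VectorBundleCore ℂ (Base r n) ℂ (Fin n → ℂ) where
  baseSet p := (chart p).source
  isOpen_baseSet p := (chart p).open_source
  indexAt x := (cover_surjective r n x).choose
  mem_baseSet_at x := by
    have h := (cover_isLocalHomeomorph r n).apply_self_mem_localInverseAt_source
      (x := (cover_surjective r n x).choose)
    rwa [(cover_surjective r n x).choose_spec] at h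
  coordChange p q x := factor r C (chart p x) (chart q x) • ContinuousLinearMap.id ℂ ℂ
  coordChange_self p x _ v := by simp [factor_self]
  continuousOn_coordChange p q := by
    refine ContinuousOn.smul
      (f := fun x : Base r n => factor r C (chart p x) (chart q x)) ?_ continuousOn_const
    have hp : ContinuousOn (chart (r := r) p) ((chart p).source ∩ (chart q).source) :=
      (chart p).continuousOn.mono Set.inter_subset_left
    have hq : ContinuousOn (chart (r := r) q) ((chart p).source ∩ (chart q).source) :=
      (chart q).continuousOn.mono Set.inter_subset_right
    have hp' := continuousOn_pi.1 hp
    have hq' := continuousOn_pi.1 hq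
    unfold factor zeta
    fun_prop
  coordChange_comp p q s x hx v := by
    have h : ∀ t : Fin n → ℂ, x ∈ (chart t).source → cover r n (chart t x) = x := fun t ht =>
      (cover_isLocalHomeomorph r n).apply_localInverseAt_of_mem ht
    have h₁ := h p hx.1.1
    have h₂ := h q hx.1.2
    have h₃ := h s hx.2
    simp only [smul_apply, ContinuousLinearMap.id_apply, smul_eq_mul]
    rw [← factor_mul r C (h₁.trans h₂.symm) (h₂.trans h₃.symm)]
    ring

/-- The changes of coordinates of the line bundle are holomorphic. -/
theorem factor_differentiableOn (r : ℕ) {n : ℕ} (C : Matrix (Fin n) (Fin n) ℤ) (q : Fin n → ℂ) :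
    DifferentiableOn ℂ (fun α => factor r C α (chart q (cover r n α)))
      (cover r n ⁻¹' (chart q).source) := by
  intro α₀ h₀
  have hl := cover_isLocalHomeomorph r n
  have hopen : IsOpen (cover r n ⁻¹' (chart q).source) :=
    (chart q).open_source.preimage hl.continuous
  have hint : ∀ α ∈ cover r n ⁻¹' (chart (r := r) q).source,
      ∃ m : Fin n → ℤ, ∀ i, chart q (cover r n α) i - α i = m i * (2 * (r : ℂ)) := fun α hα =>
    exists_int_of_cover_eq (hl.apply_localInverseAt_of_mem hα).symm
  have hc : ContinuousAt (fun α => chart q (cover r n α) - α) α₀ :=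
    (ContinuousAt.comp (f := cover r n) ((chart q).continuousAt h₀)
      hl.continuous.continuousAt).sub continuousAt_id
  have hloc : ∀ᶠ α in nhds α₀,
      chart q (cover r n α) = α + (chart q (cover r n α₀) - α₀) := by
    filter_upwards [hopen.mem_nhds h₀, Metric.continuousAt_iff'.1 hc 1 one_pos] with α hα hd
    obtain ⟨a, ha⟩ := hint α hα
    obtain ⟨b, hb⟩ := hint α₀ h₀
    funext i
    have hi := (dist_le_pi_dist _ _ i).trans_lt hd
    have e : (chart q (cover r n α) - α) i - (chart q (cover r n α₀) - α₀) i
        = (((a i - b i) * (2 * r) : ℤ) : ℂ) := by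
      simp only [Pi.sub_apply, ha, hb]
      push_cast
      ring
    rw [dist_eq_norm, e, Complex.norm_intCast] at hi
    have hz : (a i - b i) * (2 * (r : ℤ)) = 0 := Int.abs_lt_one_iff.1 (by exact_mod_cast hi)
    rw [hz] at e
    simp only [Pi.sub_apply, Int.cast_zero] at e
    simp only [Pi.add_apply, Pi.sub_apply]
    linear_combination e
  refine DifferentiableAt.differentiableWithinAt ?_
  refine DifferentiableAt.congr_of_eventuallyEq
    (f := fun α => factor r C α (α + (chart q (cover r n α₀) - α₀))) ?_
    (hloc.mono fun α h => congrArg (factor r C α) h)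
  unfold factor zeta
  fun_prop

/-- The coordinate of the section `s` in the local trivialization with index `p`, as a function of
the point `α` in the chart at `p`. -/
def localCoord {r n : ℕ} {C : Matrix (Fin n) (Fin n) ℤ} (s : ∀ x, (lineBundle r C).Fiber x)
    (p α : Fin n → ℂ) : ℂ :=
  ((lineBundle r C).localTriv p ⟨cover r n α, s (cover r n α)⟩).2

end ADO

end

/-!
The operator `E` acts on every horizontal slice of a diagram, and every layer is a homomorphism of
weight modules for the Borel subalgebra generated by `E` and `H`. If the colour of the open
component is not an integer, an endomorphism of its module that commutes with `E` and preserves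
weights is a scalar, namely its corner entry, and the corner entry of `F(T)` is entire in the
colours.

The modified dimension contributes a denominator with simple zeros at integers. If a second
component has a non-integral colour, `F(T)` factors through a module on which the identity is
`∑ Eʲ h Eʳ⁻¹⁻ʲ` for some `h`. The highest weight vector is killed by `E`, so `F(T)` maps it into the
image of `Eʳ⁻¹`, whose corner entry vanishes at the zeros of the denominator. By continuity this
holds for all colours, and dividing by a function with simple zeros gives a holomorphic function.

Translating a colour by `2r` leaves `E`, `F` and `K` unchanged and affects only the
factor `ζ^(H ⊗ H / 2)` of the braiding, which produces the linking numbers.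
-/

noncomputable section

namespace ADO

open Strand

open scoped Kronecker

/-! ### Quantum integers -/

theorem zeta_add (r : ℕ) (x y : ℂ) : zeta r (x + y) = zeta r x * zeta r y := by
  simp only [zeta, mul_add, Complex.exp_add]

@[simp]
theorem zeta_zero (r : ℕ) : zeta r 0 = 1 := by simp [zeta]

theorem zeta_ne_zero (r : ℕ) (x : ℂ) : zeta r x ≠ 0 := Complex.exp_ne_zero _

theorem zeta_neg (r : ℕ) (x : ℂ) : zeta r (-x) = (zeta r x)⁻¹ := by
  simp only [zeta, mul_neg, Complex.exp_neg]

theorem zeta_sub (r : ℕ) (x y : ℂ) : zeta r (x - y) = zeta r x / zeta r y := by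
  rw [sub_eq_add_neg, zeta_add, zeta_neg, div_eq_mul_inv]

theorem zeta_nat_mul (r k : ℕ) (x : ℂ) : zeta r (k * x) = zeta r x ^ k := by
  rw [zeta, zeta, ← Complex.exp_nat_mul]
  ring_nf

theorem zeta_sum (r : ℕ) {ι : Type*} (s : Finset ι) (f : ι → ℂ) :
    zeta r (∑ i ∈ s, f i) = ∏ i ∈ s, zeta r (f i) := by
  simp only [zeta, Finset.mul_sum, Complex.exp_sum]

theorem zeta_eq_one_iff {r : ℕ} (hr : r ≠ 0) (x : ℂ) :
    zeta r x = 1 ↔ ∃ k : ℤ, x = 2 * r * k := by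
  have h1 : (r : ℂ) ≠ 0 := Nat.cast_ne_zero.2 hr
  have h2 : (Real.pi : ℂ) ≠ 0 := Complex.ofReal_ne_zero.2 Real.pi_ne_zero
  rw [zeta, Complex.exp_eq_one_iff]
  refine exists_congr fun k => ⟨fun h => ?_, fun h => ?_⟩
  · field_simp at h
    linear_combination h
  · rw [h]
    field_simp

theorem zeta_two_mul_mul_intCast {r : ℕ} (hr : r ≠ 0) (k : ℤ) : zeta r (2 * r * k) = 1 :=
  (zeta_eq_one_iff hr _).2 ⟨k, rfl⟩

theorem zeta_add_two_mul_mul_intCast {r : ℕ} (hr : r ≠ 0) (x : ℂ) (k : ℤ) :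
    zeta r (x + 2 * r * k) = zeta r x := by
  rw [zeta_add, zeta_two_mul_mul_intCast hr, mul_one]

/-- The unnormalized quantum integer `{x} = ζ_{2r}^x - ζ_{2r}^{-x}`. The coefficients of `E` and
`F` are quotients of such numbers, and the modified dimension is the inverse of a product of
them. -/
def qInt (r : ℕ) (x : ℂ) : ℂ := zeta r x - zeta r (-x)

@[simp]
theorem qInt_zero (r : ℕ) : qInt r 0 = 0 := by simp [qInt]

theorem qInt_eq_zero_iff {r : ℕ} (hr : r ≠ 0) (x : ℂ) : qInt r x = 0 ↔ ∃ k : ℤ, x = r * k := by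
  have h : qInt r x = 0 ↔ zeta r (2 * x) = 1 := by
    rw [qInt, sub_eq_zero, two_mul, zeta_add, zeta_neg, mul_eq_one_iff_eq_inv₀ (zeta_ne_zero r x)]
  rw [h, zeta_eq_one_iff hr]
  refine exists_congr fun k => ⟨fun h => ?_, fun h => ?_⟩
  · linear_combination h / 2
  · linear_combination 2 * h

theorem qInt_natCast_self (r : ℕ) : qInt r r = 0 := by
  rcases eq_or_ne r 0 with rfl | hr
  · simp
  · exact (qInt_eq_zero_iff hr _).2 ⟨1, by simp⟩

theorem qInt_natCast_ne_zero {r k : ℕ} (h0 : k ≠ 0) (hk : k < r) : qInt r k ≠ 0 := by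
  rw [Ne, qInt_eq_zero_iff (by omega)]
  rintro ⟨m, hm⟩
  have hdvd : (r : ℤ) ∣ k := ⟨m, by exact_mod_cast hm⟩
  exact h0 (Nat.eq_zero_of_dvd_of_lt (Int.natCast_dvd_natCast.1 hdvd) hk)

theorem qInt_one_ne_zero {r : ℕ} (hr : 2 ≤ r) : qInt r 1 ≠ 0 := by
  exact_mod_cast qInt_natCast_ne_zero (r := r) one_ne_zero hr

theorem qInt_add_two_mul_mul_intCast {r : ℕ} (hr : r ≠ 0) (x : ℂ) (k : ℤ) :
    qInt r (x + 2 * r * k) = qInt r x := by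
  have h : -(x + 2 * r * k) = -x + 2 * r * (-k : ℤ) := by push_cast; ring
  rw [qInt, qInt, h, zeta_add_two_mul_mul_intCast hr, zeta_add_two_mul_mul_intCast hr]

theorem qInt_one_mul_geom_sum_zeta_neg_two (r k : ℕ) :
    qInt r 1 * ∑ i ∈ Finset.range k, zeta r (-2) ^ i = zeta r (1 - k) * qInt r k := by
  have h1 : qInt r 1 = zeta r 1 * (1 - zeta r (-2)) := by
    rw [qInt, mul_sub, mul_one, ← zeta_add]
    ring_nf
  rw [h1, mul_assoc, mul_neg_geom_sum, ← zeta_nat_mul, qInt, mul_sub, mul_sub, mul_one,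
    ← zeta_add, ← zeta_add, ← zeta_add]
  ring_nf

theorem qInt_one_mul_geom_sum_zeta_two (r k : ℕ) :
    qInt r 1 * ∑ i ∈ Finset.range k, zeta r 2 ^ i = zeta r (k - 1) * qInt r k := by
  have h1 : qInt r 1 = zeta r (-1) * (zeta r 2 - 1) := by
    rw [qInt, mul_sub, mul_one, ← zeta_add]
    ring_nf
  rw [h1, mul_assoc, mul_geom_sum, ← zeta_nat_mul, qInt, mul_sub, mul_sub, mul_one,
    ← zeta_add, ← zeta_add, ← zeta_add]
  ring_nf

/-! ### Superdiagonal matrices -/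

/-- The matrix with entries `ε 1, …, ε (r - 1)` above the diagonal: it sends the basis vector `v_i`
to `ε i • v_{i-1}`, where `v_{-1} = 0`. -/
def superdiagonal {R : Type*} [Zero R] (r : ℕ) (ε : ℕ → R) : Matrix (Fin r) (Fin r) R :=
  Matrix.of fun k i => if (k : ℕ) + 1 = i then ε i else 0

section Superdiagonal

variable {R : Type*} {r : ℕ}

theorem superdiagonal_apply [Zero R] (ε : ℕ → R) (k i : Fin r) :
    superdiagonal r ε k i = if (k : ℕ) + 1 = i then ε i else 0 := rfl

theorem superdiagonal_mul_apply [NonUnitalNonAssocSemiring R] {κ : Type*} (ε : ℕ → R)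
    (M : Matrix (Fin r) κ R) (k : Fin r) (i : κ) :
    (superdiagonal r ε * M) k i =
      if h : (k : ℕ) + 1 < r then ε (k + 1) * M ⟨k + 1, h⟩ i else 0 := by
  rw [Matrix.mul_apply]
  split_ifs with h
  · rw [Finset.sum_eq_single ⟨k + 1, h⟩ (fun b _ hb => ?_) (by simp)]
    · simp [superdiagonal_apply]
    · rw [superdiagonal_apply, if_neg fun e => hb (Fin.ext e.symm), zero_mul]
  · exact Finset.sum_eq_zero fun b _ => by
      rw [superdiagonal_apply, if_neg (by omega), zero_mul]

theorem transpose_superdiagonal_mul_apply [NonUnitalNonAssocSemiring R] {κ : Type*} (ε : ℕ → R)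
    (M : Matrix (Fin r) κ R) (k : Fin r) (i : κ) :
    ((superdiagonal r ε).transpose * M) k i =
      if (k : ℕ) = 0 then 0 else ε k * M ⟨k - 1, by omega⟩ i := by
  rw [Matrix.mul_apply]
  split_ifs with h
  · exact Finset.sum_eq_zero fun b _ => by
      rw [Matrix.transpose_apply, superdiagonal_apply, if_neg (by omega), zero_mul]
  · rw [Finset.sum_eq_single ⟨k - 1, by omega⟩ (fun b _ hb => ?_) (by simp)]
    · rw [Matrix.transpose_apply, superdiagonal_apply, if_pos (by simp; omega)]
    · have e : (b : ℕ) + 1 ≠ k := fun e => hb (Fin.ext (by simp; omega))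
      rw [Matrix.transpose_apply, superdiagonal_apply, if_neg e, zero_mul]

theorem superdiagonal_mul_transpose_superdiagonal [NonUnitalNonAssocSemiring R] {ε φ : ℕ → R}
    (h : φ r = 0) :
    superdiagonal r ε * (superdiagonal r φ).transpose =
      Matrix.diagonal fun i : Fin r => ε (i + 1) * φ (i + 1) := by
  ext k i
  simp only [superdiagonal_mul_apply, Matrix.transpose_apply, superdiagonal_apply,
    Matrix.diagonal_apply, add_left_inj, ← Fin.ext_iff, eq_comm (a := i)]
  split_ifs with hk hki
  · rfl
  · exact mul_zero _
  · rw [show (k : ℕ) + 1 = r by omega, h, mul_zero]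
  · rfl

theorem transpose_superdiagonal_mul_superdiagonal [NonUnitalNonAssocSemiring R] {ε φ : ℕ → R}
    (h : φ 0 = 0) :
    (superdiagonal r φ).transpose * superdiagonal r ε =
      Matrix.diagonal fun i : Fin r => φ i * ε i := by
  ext k i
  simp only [transpose_superdiagonal_mul_apply, superdiagonal_apply, Matrix.diagonal_apply]
  split_ifs with hk hki hki hki hki
  · rw [hk, h, zero_mul]
  · rfl
  · rw [hki]
  · omega
  · omega
  · exact mul_zero _

theorem superdiagonal_pow_apply [CommSemiring R] (ε : ℕ → R) (l : ℕ) (k i : Fin r) :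
    (superdiagonal r ε ^ l) k i =
      if (k : ℕ) + l = i then ∏ m ∈ Finset.range l, ε (k + m + 1) else 0 := by
  induction l generalizing k with
  | zero => simp [Matrix.one_apply, Fin.ext_iff]
  | succ l ih =>
    simp only [pow_succ', superdiagonal_mul_apply, ih, Finset.prod_range_succ', add_zero]
    split_ifs with h1 h2 h3 h3 h3
    · rw [mul_comm]
      congr! 3
      ring
    all_goals first | omega | simp

theorem superdiagonal_pow_self [CommSemiring R] (ε : ℕ → R) : superdiagonal r ε ^ r = 0 := by
  ext k i
  rw [superdiagonal_pow_apply, if_neg (by omega), Matrix.zero_apply]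

end Superdiagonal

theorem opE_eq_superdiagonal (r : ℕ) (α : ℂ) :
    opE r α = superdiagonal r fun i => qInt r (α - i + 1) / qInt r 1 := rfl

theorem opF_eq_transpose_superdiagonal (r : ℕ) :
    opF r = (superdiagonal r fun i => qInt r i / qInt r 1).transpose := by
  ext k i
  simp only [opF, Matrix.of_apply, Matrix.transpose_apply, superdiagonal_apply,
    eq_comm (a := (k : ℕ))]
  split_ifs with h
  · simp only [qInt, ← h, Nat.cast_add, Nat.cast_one]
  · rfl

theorem opE_pow_self (r : ℕ) (α : ℂ) : opE r α ^ r = 0 := by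
  rw [opE_eq_superdiagonal, superdiagonal_pow_self]

/-! ### The relations of the quantum group -/

/-- The action of `K ^ s` on `V_α`. -/
def opK (r : ℕ) (s α : ℂ) : Matrix (Fin r) (Fin r) ℂ := Matrix.diagonal (eigK r α s)

@[simp]
theorem opK_zero (r : ℕ) (α : ℂ) : opK r 0 α = 1 := by
  rw [opK, ← Matrix.diagonal_one]
  congr 1
  ext i
  simp [eigK]

theorem opK_mul_opF (r : ℕ) (s β : ℂ) :
    opK r s β * opF r = zeta r (-2 * s) • (opF r * opK r s β) := by
  ext k i
  simp only [opK, opF, eigK, Matrix.diagonal_mul, Matrix.mul_diagonal, Matrix.smul_apply,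
    smul_eq_mul, Matrix.of_apply, weight]
  split_ifs with h
  · rw [h, mul_comm, mul_left_comm, ← zeta_add]
    push_cast
    ring_nf
  · simp only [mul_zero, zero_mul]

theorem mul_pow_of_mul_eq_smul {R A : Type*} [CommSemiring R] [Semiring A] [Algebra R A] {t : R}
    {K F : A} (h : K * F = t • (F * K)) (k : ℕ) : K * F ^ k = t ^ k • (F ^ k * K) := by
  induction k with
  | zero => simp
  | succ k ih =>
    rw [pow_succ, ← mul_assoc, ih, smul_mul_assoc, mul_assoc, h, mul_smul_comm, smul_smul,
      ← pow_succ, mul_assoc]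

theorem opK_mul_opF_pow (r : ℕ) (s β : ℂ) (k : ℕ) :
    opK r s β * opF r ^ k = zeta r (-2 * s * k) • (opF r ^ k * opK r s β) := by
  rw [mul_pow_of_mul_eq_smul (opK_mul_opF r s β), ← zeta_nat_mul, mul_comm]

theorem mul_pow_sub_pow_mul_of_mul_eq_smul {R A : Type*} [CommRing R] [Ring A] [Algebra R A]
    {t t' : R} {E F K K' : A} (hEF : E * F - F * E = K - K') (hK : K * F = t • (F * K))
    (hK' : K' * F = t' • (F * K')) (k : ℕ) :
    E * F ^ (k + 1) - F ^ (k + 1) * E =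
      F ^ k * ((∑ i ∈ Finset.range (k + 1), t ^ i) • K -
        (∑ i ∈ Finset.range (k + 1), t' ^ i) • K') := by
  induction k with
  | zero => simpa using hEF
  | succ k ih =>
    have hleibniz : E * F ^ (k + 1 + 1) - F ^ (k + 1 + 1) * E =
        F * (E * F ^ (k + 1) - F ^ (k + 1) * E) + (E * F - F * E) * F ^ (k + 1) := by
      rw [pow_succ' F (k + 1)]
      noncomm_ring
    rw [hleibniz, ih, hEF, sub_mul, mul_pow_of_mul_eq_smul hK, mul_pow_of_mul_eq_smul hK',
      Finset.sum_range_succ _ (k + 1), Finset.sum_range_succ _ (k + 1), ← mul_assoc, ← pow_succ',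
      ← mul_smul_comm, ← mul_smul_comm, ← mul_sub, ← mul_add]
    congr 1
    module

theorem opE_mul_opF_sub_opF_mul_opE {r : ℕ} (hr : 2 ≤ r) (β : ℂ) :
    opE r β * opF r - opF r * opE r β = (qInt r 1)⁻¹ • opK r 1 β - (qInt r 1)⁻¹ • opK r (-1) β := by
  have hq := qInt_one_ne_zero hr
  rw [opF_eq_transpose_superdiagonal, opE_eq_superdiagonal,
    superdiagonal_mul_transpose_superdiagonal (by simp [qInt_natCast_self]),
    transpose_superdiagonal_mul_superdiagonal (by simp), Matrix.diagonal_sub, opK, opK,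
    ← Matrix.diagonal_smul, ← Matrix.diagonal_smul, Matrix.diagonal_sub]
  congr 1
  funext i
  have key (x y : ℂ) : qInt r x * qInt r (y + 1) - qInt r y * qInt r (x + 1) =
      qInt r 1 * (zeta r (x - y) - zeta r (-(x - y))) := by
    simp only [qInt, neg_sub, neg_add, zeta_sub, zeta_add, zeta_neg]
    field [zeta_ne_zero r]
  have e₁ : β - ((i + 1 : ℕ) : ℂ) + 1 = β - (i : ℕ) := by push_cast; ring
  have e₂ : β - (i : ℕ) - (i : ℕ) = β - 2 * (i : ℕ) := by ring
  simp only [Pi.smul_apply, smul_eq_mul, eigK, weight, one_mul, neg_mul, ← mul_sub, e₁, ← e₂]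
  rw [Nat.cast_succ, div_mul_div_comm, div_mul_div_comm, ← sub_div, key]
  field_simp

theorem opE_mul_opF_pow_sub_opF_pow_mul_opE {r : ℕ} (hr : 2 ≤ r) (β : ℂ) (k : ℕ) :
    opE r β * opF r ^ (k + 1) - opF r ^ (k + 1) * opE r β =
      (qInt r (k + 1) / qInt r 1 ^ 2) •
        (opF r ^ k * (zeta r (-k) • opK r 1 β - zeta r k • opK r (-1) β)) := by
  have hq := qInt_one_ne_zero hr
  have hK (s : ℂ) : (qInt r 1)⁻¹ • opK r s β * opF r =
      zeta r (-2 * s) • (opF r * (qInt r 1)⁻¹ • opK r s β) := by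
    rw [smul_mul_assoc, opK_mul_opF, mul_smul_comm, smul_comm]
  have h₁ := qInt_one_mul_geom_sum_zeta_neg_two r (k + 1)
  have h₂ := qInt_one_mul_geom_sum_zeta_two r (k + 1)
  rw [mul_comm, ← eq_div_iff hq] at h₁ h₂
  rw [mul_pow_sub_pow_mul_of_mul_eq_smul (opE_mul_opF_sub_opF_mul_opE hr β) (hK 1) (hK (-1)),
    mul_one, show (-2 : ℂ) * -1 = 2 by norm_num, h₁, h₂, ← mul_smul_comm]
  congr 1
  push_cast
  rw [smul_sub, smul_smul, smul_smul, smul_smul, smul_smul]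
  ring_nf

/-! ### The `R`-matrix -/

theorem kronecker_sub {R l m n p : Type*} [NonUnitalNonAssocRing R] (A : Matrix l m R)
    (B B' : Matrix n p R) : A ⊗ₖ (B - B') = A ⊗ₖ B - A ⊗ₖ B' := by
  ext
  simp only [Matrix.kroneckerMap_apply, Matrix.sub_apply, mul_sub]

section TruncExp

variable {R l m : Type*} [CommRing R] [Fintype l] [DecidableEq l] [Fintype m] [DecidableEq m]

/-- The truncated power series `∑_{k < N} c_k (E ⊗ F)^k`, the common shape of the truncated
`R`-matrix and of its inverse. -/
def truncExp (N : ℕ) (c : ℕ → R) (E : Matrix l l R) (F : Matrix m m R) :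
    Matrix (l × m) (l × m) R :=
  ∑ k ∈ Finset.range N, c k • ((E ^ k) ⊗ₖ (F ^ k))

theorem truncExp_mul_eq_mul_truncExp {N : ℕ} {c : ℕ → R} {E : Matrix l l R}
    {F B M M' : Matrix m m R} (hE : E ^ N = 0)
    (h : ∀ k, k + 1 < N →
      c (k + 1) • (B * F ^ (k + 1) - F ^ (k + 1) * B) = c k • (F ^ k * M - M' * F ^ k)) :
    truncExp N c E F * (E ⊗ₖ M + 1 ⊗ₖ B) = (E ⊗ₖ M' + 1 ⊗ₖ B) * truncExp N c E F := by
  let g (k : ℕ) := (E ^ k) ⊗ₖ (c k • (B * F ^ k - F ^ k * B))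
  have hterm (k : ℕ) (hk : k ∈ Finset.range N) :
      c k • ((E ^ k) ⊗ₖ (F ^ k)) * (E ⊗ₖ M + 1 ⊗ₖ B) -
        (E ⊗ₖ M' + 1 ⊗ₖ B) * c k • ((E ^ k) ⊗ₖ (F ^ k)) = g (k + 1) - g k := by
    have hsucc : g (k + 1) = (E ^ (k + 1)) ⊗ₖ (c k • (F ^ k * M - M' * F ^ k)) := by
      rcases (Nat.succ_le_of_lt (Finset.mem_range.1 hk)).lt_or_eq with hlt | heq
      · simp only [g, h k hlt]
      · simp only [g, ← Nat.succ_eq_add_one, heq, hE, Matrix.zero_kronecker]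
    rw [hsucc]
    simp only [g, smul_mul_assoc, mul_smul_comm, mul_add, add_mul, ← Matrix.mul_kronecker_mul,
      one_mul, mul_one, ← pow_succ, ← pow_succ', Matrix.kronecker_smul, kronecker_sub,
      ← smul_sub, ← smul_add]
    congr 1
    abel
  rw [← sub_eq_zero, truncExp, Finset.sum_mul, Finset.mul_sum, ← Finset.sum_sub_distrib,
    Finset.sum_congr rfl hterm, Finset.sum_range_sub]
  simp [g, hE]

end TruncExp

theorem opHH_mul_opE_kronecker_opK (r : ℕ) (s t α β : ℂ) :
    opHH r s α β * (opE r α ⊗ₖ opK r t β) = (opE r α ⊗ₖ opK r (t + s) β) * opHH r s α β := by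
  ext ⟨a, b⟩ ⟨a', b'⟩
  simp only [opHH, opK, eigK, Matrix.diagonal_mul, Matrix.mul_diagonal,
    Matrix.kroneckerMap_apply, opE, Matrix.of_apply, Matrix.diagonal_apply]
  split_ifs with h1 h2
  · subst h2
    rw [mul_left_comm, ← zeta_add, mul_assoc, ← zeta_add]
    congr 2
    simp only [weight, ← h1, Nat.cast_add, Nat.cast_one]
    ring
  all_goals simp only [mul_zero, zero_mul]

theorem opHH_mul_opK_kronecker_opE (r : ℕ) (s t α β : ℂ) :
    opHH r s α β * (opK r t α ⊗ₖ opE r β) = (opK r (t + s) α ⊗ₖ opE r β) * opHH r s α β := by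
  ext ⟨a, b⟩ ⟨a', b'⟩
  simp only [opHH, opK, eigK, Matrix.diagonal_mul, Matrix.mul_diagonal,
    Matrix.kroneckerMap_apply, opE, Matrix.of_apply, Matrix.diagonal_apply]
  split_ifs with h2 h1 h1
  · subst h2
    rw [← mul_assoc, ← zeta_add, mul_right_comm, ← zeta_add]
    congr 2
    simp only [weight, ← h1, Nat.cast_add, Nat.cast_one]
    ring
  all_goals simp only [mul_zero, zero_mul]

theorem qPochhammer_succ (r k : ℕ) :
    qPochhammer (zeta r (-2)) (zeta r (-2)) (k + 1) =
      qPochhammer (zeta r (-2)) (zeta r (-2)) k * (zeta r (-(k + 1)) * qInt r (k + 1)) := by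
  rw [qPochhammer, qPochhammer, Finset.prod_range_succ, ← pow_succ', ← zeta_nat_mul, qInt,
    mul_sub (zeta _ _), ← zeta_add, ← zeta_add, neg_add_cancel, zeta_zero]
  push_cast
  ring_nf

/-- The coefficients of the truncated `R`-matrix. -/
def rCoeff (r k : ℕ) : ℂ :=
  qInt r 1 ^ (2 * k) / (zeta r k * qPochhammer (zeta r (-2)) (zeta r (-2)) k)

/-- The coefficients of the inverse of the truncated `R`-matrix. -/
def rInvCoeff (r k : ℕ) : ℂ :=
  (-1) ^ k * qInt r 1 ^ (2 * k) /
    (zeta r ((k : ℂ) ^ 2) * qPochhammer (zeta r (-2)) (zeta r (-2)) k)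

theorem rCoeff_succ_mul_qInt {r k : ℕ} (hk : k + 1 < r) :
    rCoeff r (k + 1) * qInt r (k + 1) = rCoeff r k * zeta r k * qInt r 1 ^ 2 := by
  have h0 : qInt r (k + 1) ≠ 0 := by exact_mod_cast qInt_natCast_ne_zero k.succ_ne_zero hk
  have h1 : zeta r ((k + 1 : ℕ) : ℂ) * zeta r (-(k + 1)) = 1 := by
    rw [← zeta_add, Nat.cast_succ, add_neg_cancel, zeta_zero]
  have h2 := zeta_ne_zero r k
  rw [rCoeff, rCoeff, qPochhammer_succ, mul_left_comm, ← mul_assoc (zeta r _) (zeta r _), h1,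
    one_mul, ← div_div, div_mul_cancel₀ _ h0]
  field

theorem rInvCoeff_succ_mul_qInt {r k : ℕ} (hk : k + 1 < r) :
    rInvCoeff r (k + 1) * qInt r (k + 1) = rInvCoeff r k * -zeta r (-k) * qInt r 1 ^ 2 := by
  have h0 : qInt r (k + 1) ≠ 0 := by exact_mod_cast qInt_natCast_ne_zero k.succ_ne_zero hk
  have h1 : zeta r (((k + 1 : ℕ) : ℂ) ^ 2) * zeta r (-(k + 1)) = zeta r ((k : ℂ) ^ 2 + k) := by
    rw [← zeta_add, Nat.cast_succ]
    ring_nf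
  have h2 := zeta_ne_zero r k
  rw [rInvCoeff, rInvCoeff, qPochhammer_succ, mul_left_comm, ← mul_assoc (zeta r _) (zeta r _), h1,
    mul_left_comm, ← mul_assoc, ← div_div, div_mul_cancel₀ _ h0, zeta_add, zeta_neg r k]
  field

theorem truncExp_opE_opF_mul {r : ℕ} (hr : 2 ≤ r) (α β : ℂ) {c u : ℕ → ℂ}
    {M M' : Matrix (Fin r) (Fin r) ℂ}
    (hc : ∀ k, k + 1 < r → c (k + 1) * qInt r (k + 1) = c k * u k * qInt r 1 ^ 2)
    (hM : ∀ k, opF r ^ k * M - M' * opF r ^ k =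
      u k • (opF r ^ k * (zeta r (-k) • opK r 1 β - zeta r k • opK r (-1) β))) :
    truncExp r c (opE r α) (opF r) * (opE r α ⊗ₖ M + 1 ⊗ₖ opE r β) =
      (opE r α ⊗ₖ M' + 1 ⊗ₖ opE r β) * truncExp r c (opE r α) (opF r) := by
  have hq := pow_ne_zero 2 (qInt_one_ne_zero hr)
  refine truncExp_mul_eq_mul_truncExp (opE_pow_self r α) fun k hk => ?_
  rw [opE_mul_opF_pow_sub_opF_pow_mul_opE hr, hM, smul_smul, smul_smul, mul_div_assoc', hc k hk,
    mul_div_cancel_right₀ _ hq]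

theorem truncExp_rCoeff_mul {r : ℕ} (hr : 2 ≤ r) (α β : ℂ) :
    truncExp r (rCoeff r) (opE r α) (opF r) * (opE r α ⊗ₖ opK r 1 β + 1 ⊗ₖ opE r β) =
      (opE r α ⊗ₖ opK r (-1) β + 1 ⊗ₖ opE r β) * truncExp r (rCoeff r) (opE r α) (opF r) := by
  refine truncExp_opE_opF_mul hr α β (fun k => rCoeff_succ_mul_qInt) fun k => ?_
  rw [opK_mul_opF_pow, ← mul_smul_comm, ← mul_smul_comm, ← mul_sub, smul_sub, smul_smul, smul_smul,
    ← zeta_add, ← zeta_add, add_neg_cancel, zeta_zero, one_smul]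
  ring_nf

theorem truncExp_rInvCoeff_mul {r : ℕ} (hr : 2 ≤ r) (α β : ℂ) :
    truncExp r (rInvCoeff r) (opE r α) (opF r) * (opE r α ⊗ₖ opK r (-1) β + 1 ⊗ₖ opE r β) =
      (opE r α ⊗ₖ opK r 1 β + 1 ⊗ₖ opE r β) * truncExp r (rInvCoeff r) (opE r α) (opF r) := by
  refine truncExp_opE_opF_mul hr α β (fun k => rInvCoeff_succ_mul_qInt) fun k => ?_
  rw [opK_mul_opF_pow, ← mul_smul_comm, ← mul_smul_comm, ← mul_sub, smul_sub, smul_smul, smul_smul,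
    neg_mul (zeta r _), neg_mul (zeta r _), ← zeta_add, ← zeta_add, neg_add_cancel, zeta_zero,
    show (-2 : ℂ) * 1 * k = -k + -k by ring]
  congr 1
  module

theorem opR_mul {r : ℕ} (hr : 2 ≤ r) (α β : ℂ) :
    opR r α β * (opE r α ⊗ₖ opK r 1 β + 1 ⊗ₖ opE r β) =
      (opE r α ⊗ₖ 1 + opK r 1 α ⊗ₖ opE r β) * opR r α β := by
  have h1 := opHH_mul_opE_kronecker_opK r 1 (-1) α β
  have h2 := opHH_mul_opK_kronecker_opE r 1 0 α β
  rw [neg_add_cancel, opK_zero] at h1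
  rw [zero_add, opK_zero] at h2
  change opHH r 1 α β * truncExp r (rCoeff r) (opE r α) (opF r) * _ = _
  rw [mul_assoc, truncExp_rCoeff_mul hr, ← mul_assoc, mul_add, h1, h2, ← add_mul, mul_assoc]
  rfl

theorem opRInv_mul {r : ℕ} (hr : 2 ≤ r) (α β : ℂ) :
    opRInv r α β * (opE r α ⊗ₖ 1 + opK r 1 α ⊗ₖ opE r β) =
      (opE r α ⊗ₖ opK r 1 β + 1 ⊗ₖ opE r β) * opRInv r α β := by
  have h1 := opHH_mul_opE_kronecker_opK r (-1) 0 α β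
  have h2 := opHH_mul_opK_kronecker_opE r (-1) 1 α β
  rw [zero_add, opK_zero] at h1
  rw [add_neg_cancel, opK_zero] at h2
  change truncExp r (rInvCoeff r) (opE r α) (opF r) * opHH r (-1) α β * _ = _
  rw [mul_assoc, mul_add (opHH _ _ _ _), h1, h2, ← add_mul, ← mul_assoc,
    truncExp_rInvCoeff_mul hr, mul_assoc]
  rfl

/-! ### Weight modules over the Borel subalgebra -/

/-- The matrix `A` maps every basis vector of weight `x` to a combination of basis vectors of
weight `x + d`. -/
def IsHomogeneous {Γ R S T : Type*} [Add Γ] [Zero R] (wt : S → Γ) (wt' : T → Γ) (d : Γ)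
    (A : Matrix T S R) : Prop :=
  ∀ ⦃b a⦄, A b a ≠ 0 → wt' b = wt a + d

namespace IsHomogeneous

variable {Γ R S T U S' T' ι : Type*} [AddCommMonoid Γ] [Semiring R] {wt : S → Γ} {wt' : T → Γ}
  {wt'' : U → Γ} {d e : Γ}

theorem diagonal [DecidableEq S] (wt : S → Γ) (f : S → R) :
    IsHomogeneous wt wt 0 (Matrix.diagonal f) := by
  intro b a h
  obtain rfl : b = a := by
    by_contra hba
    exact h (Matrix.diagonal_apply_ne _ hba)
  rw [add_zero]

theorem one [DecidableEq S] (wt : S → Γ) : IsHomogeneous wt wt 0 (1 : Matrix S S R) := by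
  rw [← Matrix.diagonal_one]
  exact diagonal wt _

theorem add {A B : Matrix T S R} (hA : IsHomogeneous wt wt' d A) (hB : IsHomogeneous wt wt' d B) :
    IsHomogeneous wt wt' d (A + B) := by
  intro b a h
  by_cases h1 : A b a = 0
  · exact hB fun h2 => h (by rw [Matrix.add_apply, h1, h2, add_zero])
  · exact hA h1

theorem smul {A : Matrix T S R} (hA : IsHomogeneous wt wt' d A) (z : R) :
    IsHomogeneous wt wt' d (z • A) :=
  fun _ _ h => hA (right_ne_zero_of_mul h)

theorem sum {s : Finset ι} {A : ι → Matrix T S R} (hA : ∀ i ∈ s, IsHomogeneous wt wt' d (A i)) :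
    IsHomogeneous wt wt' d (∑ i ∈ s, A i) := by
  intro b a h
  rw [Matrix.sum_apply] at h
  obtain ⟨i, hi, hne⟩ := Finset.exists_ne_zero_of_sum_ne_zero h
  exact hA i hi hne

theorem mul [Fintype T] {A : Matrix T S R} {B : Matrix U T R} (hB : IsHomogeneous wt' wt'' e B)
    (hA : IsHomogeneous wt wt' d A) : IsHomogeneous wt wt'' (d + e) (B * A) := by
  intro b a h
  obtain ⟨c, _, hc⟩ := Finset.exists_ne_zero_of_sum_ne_zero h
  rw [hB (left_ne_zero_of_mul hc), hA (right_ne_zero_of_mul hc), add_assoc]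

theorem pow [Fintype S] [DecidableEq S] {A : Matrix S S R} (hA : IsHomogeneous wt wt d A) (k : ℕ) :
    IsHomogeneous wt wt (k • d) (A ^ k) := by
  induction k with
  | zero => simpa only [zero_nsmul, pow_zero] using one wt
  | succ k ih => simpa only [pow_succ', succ_nsmul] using hA.mul ih

theorem kronecker {ωS : S → Γ} {ωT : T → Γ} {ωS' : S' → Γ} {ωT' : T' → Γ} {A : Matrix S' S R}
    {B : Matrix T' T R} (hA : IsHomogeneous ωS ωS' d A) (hB : IsHomogeneous ωT ωT' e B) :
    IsHomogeneous (fun p : S × T => ωS p.1 + ωT p.2) (fun p : S' × T' => ωS' p.1 + ωT' p.2)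
      (d + e) (A ⊗ₖ B) := by
  intro b a h
  simp only [hA (left_ne_zero_of_mul h), hB (right_ne_zero_of_mul h)]
  exact add_add_add_comm _ _ _ _

theorem diagonal_zeta_mul (r : ℕ) [Fintype S] [Fintype T] [DecidableEq S] [DecidableEq T]
    {wt : S → ℂ} {wt' : T → ℂ} {d : ℂ} {A : Matrix T S ℂ} (h : IsHomogeneous wt wt' d A) (s : ℂ) :
    Matrix.diagonal (fun t => zeta r (s * wt' t)) * A =
      zeta r (s * d) • (A * Matrix.diagonal fun t => zeta r (s * wt t)) := by
  ext b a
  simp only [Matrix.diagonal_mul, Matrix.mul_diagonal, Matrix.smul_apply, smul_eq_mul]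
  by_cases h0 : A b a = 0
  · simp only [h0, mul_zero, zero_mul]
  · rw [h h0, mul_add, zeta_add]
    ring

end IsHomogeneous

/-- A weight module over the Borel subalgebra generated by `E` and `H`, with a basis of weight
vectors indexed by `S`. -/
structure BorelModule (S : Type*) where
  /-- The weight of a basis vector. -/
  wt : S → ℂ
  /-- The action of `E`. -/
  E : Matrix S S ℂ
  isHomogeneous_E : IsHomogeneous wt wt 2 E

namespace BorelModule

/-- The action of `K ^ s` on a weight module. -/
def K {S : Type*} [DecidableEq S] (r : ℕ) (M : BorelModule S) (s : ℂ) : Matrix S S ℂ :=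
  Matrix.diagonal fun a => zeta r (s * M.wt a)

/-- The trivial module. -/
def unit : BorelModule Unit := ⟨fun _ => 0, 0, fun _ _ h => absurd rfl h⟩

/-- The tensor product, where `E` acts by `E ⊗ K + 1 ⊗ E`. -/
def tensor {S T : Type*} [DecidableEq S] [DecidableEq T] (r : ℕ) (M : BorelModule S)
    (N : BorelModule T) : BorelModule (S × T) where
  wt p := M.wt p.1 + N.wt p.2
  E := M.E ⊗ₖ N.K r 1 + 1 ⊗ₖ N.E
  isHomogeneous_E := by
    have h₁ := M.isHomogeneous_E.kronecker
      (IsHomogeneous.diagonal N.wt fun a => zeta r (1 * N.wt a))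
    have h₂ := (IsHomogeneous.one (R := ℂ) M.wt).kronecker N.isHomogeneous_E
    rw [add_zero] at h₁
    rw [zero_add] at h₂
    exact h₁.add h₂

/-- A homomorphism of weight modules, given by its matrix. -/
structure IsHom {S T : Type*} [Fintype S] [Fintype T] (M : BorelModule S) (N : BorelModule T)
    (A : Matrix T S ℂ) : Prop where
  homogeneous : IsHomogeneous M.wt N.wt 0 A
  mul_E : A * M.E = N.E * A

section

variable {S T U : Type*} [DecidableEq S] [DecidableEq T] [DecidableEq U]

theorem K_tensor (r : ℕ) (M : BorelModule S) (N : BorelModule T) (s : ℂ) :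
    (M.tensor r N).K r s = M.K r s ⊗ₖ N.K r s := by
  simp only [K, tensor, mul_add, zeta_add, Matrix.diagonal_kronecker_diagonal]

theorem K_add [Fintype S] (r : ℕ) (M : BorelModule S) (s t : ℂ) :
    M.K r (s + t) = M.K r s * M.K r t := by
  simp only [K, add_mul, zeta_add, Matrix.diagonal_mul_diagonal]

theorem K_zero (r : ℕ) (M : BorelModule S) : M.K r 0 = 1 := by
  simp only [K, zero_mul, zeta_zero, Matrix.diagonal_one]

theorem K_mul_E [Fintype S] (r : ℕ) (M : BorelModule S) (s : ℂ) :
    M.K r s * M.E = zeta r (s * 2) • (M.E * M.K r s) :=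
  M.isHomogeneous_E.diagonal_zeta_mul r s

theorem tensor_assoc_wt (r : ℕ) (M : BorelModule S) (N : BorelModule T) (P : BorelModule U) :
    (M.tensor r (N.tensor r P)).wt =
      ((M.tensor r N).tensor r P).wt ∘ (Equiv.prodAssoc S T U).symm :=
  funext fun _ => (add_assoc _ _ _).symm

theorem tensor_assoc_E (r : ℕ) (M : BorelModule S) (N : BorelModule T) (P : BorelModule U) :
    (M.tensor r (N.tensor r P)).E =
      ((M.tensor r N).tensor r P).E.submatrix (Equiv.prodAssoc S T U).symm
        (Equiv.prodAssoc S T U).symm := by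
  have hKP : (N.tensor r P).K r 1 = N.K r 1 ⊗ₖ P.K r 1 := K_tensor r N P 1
  have hE : ((M.tensor r N).tensor r P).E =
      (M.E ⊗ₖ N.K r 1 + 1 ⊗ₖ N.E) ⊗ₖ P.K r 1 + 1 ⊗ₖ P.E := rfl
  have hE' : (M.tensor r (N.tensor r P)).E =
      M.E ⊗ₖ (N.tensor r P).K r 1 + 1 ⊗ₖ (N.E ⊗ₖ P.K r 1 + 1 ⊗ₖ P.E) := rfl
  rw [hE, hE', hKP, ← Matrix.one_kronecker_one (m := S) (n := T)]
  ext ⟨a, b, c⟩ ⟨a', b', c'⟩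
  simp only [Matrix.add_apply, Matrix.kroneckerMap_apply, Matrix.submatrix_apply,
    Equiv.prodAssoc_symm_apply]
  ring

theorem unit_tensor_wt (r : ℕ) (M : BorelModule S) :
    M.wt = (unit.tensor r M).wt ∘ (Equiv.punitProd S).symm :=
  funext fun _ => (zero_add _).symm

theorem unit_tensor_E (r : ℕ) (M : BorelModule S) :
    M.E = (unit.tensor r M).E.submatrix (Equiv.punitProd S).symm (Equiv.punitProd S).symm := by
  ext a b
  simp [tensor, unit]

end

namespace IsHom

variable {S T U S' T' : Type*} [Fintype S] [Fintype T] [Fintype U] [Fintype S'] [Fintype T']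

theorem one [DecidableEq S] (M : BorelModule S) : M.IsHom M 1 :=
  ⟨.one _, by rw [one_mul, mul_one]⟩

theorem mul {M : BorelModule S} {N : BorelModule T} {P : BorelModule U} {A : Matrix T S ℂ}
    {B : Matrix U T ℂ} (hB : N.IsHom P B) (hA : M.IsHom N A) : M.IsHom P (B * A) where
  homogeneous := by simpa only [add_zero] using hB.homogeneous.mul hA.homogeneous
  mul_E := by rw [Matrix.mul_assoc, hA.mul_E, ← Matrix.mul_assoc, hB.mul_E, Matrix.mul_assoc]

theorem mul_K [DecidableEq S] [DecidableEq T] {M : BorelModule S} {N : BorelModule T}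
    {A : Matrix T S ℂ} (hA : M.IsHom N A) (r : ℕ) (s : ℂ) : A * M.K r s = N.K r s * A := by
  have h := hA.homogeneous.diagonal_zeta_mul r s
  rw [mul_zero, zeta_zero, one_smul] at h
  exact h.symm

theorem tensor_one (r : ℕ) [DecidableEq S] [DecidableEq S'] [DecidableEq T] {M : BorelModule S}
    {M' : BorelModule S'} {A : Matrix S' S ℂ} (hA : M.IsHom M' A) (N : BorelModule T) :
    (M.tensor r N).IsHom (M'.tensor r N) (A ⊗ₖ 1) where
  homogeneous := by
    have h := hA.homogeneous.kronecker (.one N.wt)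
    rwa [add_zero] at h
  mul_E := by
    simp only [tensor, Matrix.mul_add, Matrix.add_mul, ← Matrix.mul_kronecker_mul, Matrix.one_mul,
      Matrix.mul_one, hA.mul_E]

theorem one_tensor (r : ℕ) [DecidableEq S] [DecidableEq T] [DecidableEq T'] {N : BorelModule T}
    {N' : BorelModule T'} {A : Matrix T' T ℂ} (M : BorelModule S) (hA : N.IsHom N' A) :
    (M.tensor r N).IsHom (M.tensor r N') (1 ⊗ₖ A) where
  homogeneous := by
    have h := (IsHomogeneous.one M.wt).kronecker hA.homogeneous
    rwa [add_zero] at h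
  mul_E := by
    simp only [tensor, Matrix.mul_add, Matrix.add_mul, ← Matrix.mul_kronecker_mul, Matrix.one_mul,
      Matrix.mul_one, hA.mul_E, hA.mul_K]

theorem submatrix {M : BorelModule S} {N : BorelModule T} {A : Matrix T S ℂ} (hA : M.IsHom N A)
    {M' : BorelModule S'} {N' : BorelModule T'} (e : S' ≃ S) (f : T' ≃ T) (hM : M'.wt = M.wt ∘ e)
    (hN : N'.wt = N.wt ∘ f) (hM' : M'.E = M.E.submatrix e e) (hN' : N'.E = N.E.submatrix f f) :
    M'.IsHom N' (A.submatrix f e) where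
  homogeneous b a h := by
    rw [hM, hN]
    exact hA.homogeneous h
  mul_E := by rw [hM', hN', Matrix.submatrix_mul_equiv, Matrix.submatrix_mul_equiv, hA.mul_E]

theorem tensor_left_of_unit {r : ℕ} [DecidableEq S] [DecidableEq T] [DecidableEq U]
    {M : BorelModule S} {N : BorelModule T} {A : Matrix (S × T) Unit ℂ}
    (hA : unit.IsHom (M.tensor r N) A) (P : BorelModule U) :
    P.IsHom (M.tensor r (N.tensor r P))
      ((A ⊗ₖ (1 : Matrix U U ℂ)).submatrix (Equiv.prodAssoc _ _ _).symm (Equiv.punitProd U).symm) :=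
  (hA.tensor_one r P).submatrix _ _ (unit_tensor_wt r P) (tensor_assoc_wt r M N P)
    (unit_tensor_E r P) (tensor_assoc_E r M N P)

theorem tensor_left_to_unit {r : ℕ} [DecidableEq S] [DecidableEq T] [DecidableEq U]
    {M : BorelModule S} {N : BorelModule T} {A : Matrix Unit (S × T) ℂ}
    (hA : (M.tensor r N).IsHom unit A) (P : BorelModule U) :
    (M.tensor r (N.tensor r P)).IsHom P
      ((A ⊗ₖ (1 : Matrix U U ℂ)).submatrix (Equiv.punitProd U).symm (Equiv.prodAssoc _ _ _).symm) :=
  (hA.tensor_one r P).submatrix _ _ (tensor_assoc_wt r M N P) (unit_tensor_wt r P)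
    (tensor_assoc_E r M N P) (unit_tensor_E r P)

theorem tensor_left {r : ℕ} [DecidableEq S] [DecidableEq T] [DecidableEq S'] [DecidableEq T']
    [DecidableEq U] {M : BorelModule S} {N : BorelModule T} {M' : BorelModule S'}
    {N' : BorelModule T'} {A : Matrix (S' × T') (S × T) ℂ}
    (hA : (M.tensor r N).IsHom (M'.tensor r N') A) (P : BorelModule U) :
    (M.tensor r (N.tensor r P)).IsHom (M'.tensor r (N'.tensor r P))
      ((A ⊗ₖ (1 : Matrix U U ℂ)).submatrix (Equiv.prodAssoc _ _ _).symm
        (Equiv.prodAssoc _ _ _).symm) :=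
  (hA.tensor_one r P).submatrix _ _ (tensor_assoc_wt r M N P) (tensor_assoc_wt r M' N' P)
    (tensor_assoc_E r M N P) (tensor_assoc_E r M' N' P)

theorem of_forall_apply_eq {M : BorelModule S} {N : BorelModule T} {A B : Matrix T S ℂ}
    (hA : M.IsHom N A) (h : ∀ b a, B b a = A b a) : M.IsHom N B :=
  Matrix.ext h ▸ hA

theorem cup {r : ℕ} [DecidableEq S] {M N : BorelModule S} {g : S → ℂ}
    (hwt : ∀ a, M.wt a + N.wt a = 0)
    (hE : ∀ a b, M.E a b * zeta r (N.wt b) * g b + N.E b a * g a = 0) :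
    unit.IsHom (M.tensor r N) (Matrix.of fun p _ => if p.1 = p.2 then g p.1 else 0) where
  homogeneous := by
    rintro ⟨a, b⟩ _ h
    obtain rfl : a = b := by
      by_contra hab
      exact h (if_neg hab)
    exact (hwt a).trans (add_zero 0).symm
  mul_E := by
    ext ⟨a, b⟩ _
    simp only [unit, tensor, K, Matrix.mul_apply, Fintype.sum_prod_type, Matrix.add_apply,
      Matrix.kroneckerMap_apply, Matrix.of_apply, Matrix.diagonal_apply, Matrix.one_apply,
      Matrix.zero_apply, mul_zero, Finset.sum_const_zero, one_mul, mul_ite, Finset.sum_ite_eq,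
      Finset.mem_univ, if_true, ite_mul, zero_mul, add_mul, Finset.sum_add_distrib]
    exact (hE a b).symm

theorem cap {r : ℕ} [DecidableEq S] {M N : BorelModule S} {g : S → ℂ}
    (hwt : ∀ a, M.wt a + N.wt a = 0)
    (hE : ∀ a b, g b * (M.E b a * zeta r (N.wt b)) + g a * N.E a b = 0) :
    (M.tensor r N).IsHom unit (Matrix.of fun _ p => if p.1 = p.2 then g p.1 else 0) where
  homogeneous := by
    rintro _ ⟨a, b⟩ h
    obtain rfl : a = b := by
      by_contra hab
      exact h (if_neg hab)
    exact (hwt a).symm.trans (add_zero _).symm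
  mul_E := by
    ext _ ⟨a, b⟩
    simp only [unit, tensor, K, Matrix.mul_apply, Fintype.sum_prod_type, Matrix.add_apply,
      Matrix.kroneckerMap_apply, Matrix.of_apply, Matrix.diagonal_apply, Matrix.one_apply,
      Matrix.zero_apply, mul_zero, zero_mul, one_mul, mul_ite, ite_mul, mul_add,
      Finset.sum_add_distrib, Finset.sum_ite_eq, Finset.sum_ite_eq', Finset.mem_univ, if_true,
      Finset.sum_const_zero, Finset.sum_ite_irrel, ite_self]
    exact hE a b

end IsHom

end BorelModule

/-! ### The modules of strands and of horizontal lines -/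

open BorelModule

theorem isHomogeneous_opE (r : ℕ) (α : ℂ) :
    IsHomogeneous (weight α) (weight α) 2 (opE r α) := by
  intro b a h
  have e : (b : ℕ) + 1 = a := by
    by_contra hba
    exact h (if_neg hba)
  simp only [weight, ← e]
  push_cast
  ring

theorem isHomogeneous_opF (r : ℕ) (α : ℂ) :
    IsHomogeneous (weight α) (weight α) (-2) (opF r) := by
  intro b a h
  have e : (b : ℕ) = a + 1 := by
    by_contra hba
    exact h (if_neg hba)
  simp only [weight, e]
  push_cast
  ring

/-- The module `V_α`. -/
def verma (r : ℕ) (α : ℂ) : BorelModule (Fin r) where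
  wt := weight α
  E := opE r α
  isHomogeneous_E := isHomogeneous_opE r α

/-- The dual of `V_α`, with the dual basis: `E` acts by the transpose of its antipode
`-E K⁻¹`. -/
def vermaDual (r : ℕ) (α : ℂ) : BorelModule (Fin r) where
  wt a := -weight α a
  E := (-(opE r α * opK r (-1) α)).transpose
  isHomogeneous_E b a h := by
    have hE : opE r α a b ≠ 0 := by
      rw [Matrix.transpose_apply, Matrix.neg_apply, opK, Matrix.mul_diagonal] at h
      exact left_ne_zero_of_mul (neg_ne_zero.1 h)
    linear_combination isHomogeneous_opE r α hE

theorem vermaDual_E_apply (r : ℕ) (α : ℂ) (b a : Fin r) :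
    (vermaDual r α).E b a = -(opE r α a b * zeta r (-weight α b)) := by
  change -(opE r α * Matrix.diagonal (eigK r α (-1))) a b = _
  rw [Matrix.mul_diagonal, eigK, neg_one_mul]

/-- The module attached to a strand. -/
def strandModule {n : ℕ} (r : ℕ) (α : Fin n → ℂ) : Strand n → BorelModule (Fin r)
  | down i => verma r (α i)
  | up i => vermaDual r (α i)

/-- The tensor product of the modules of the strands crossing a horizontal line. -/
def lineModule {n : ℕ} (r : ℕ) (α : Fin n → ℂ) : (w : List (Strand n)) → BorelModule (State r w)
  | [] => BorelModule.unit
  | x :: w => (strandModule r α x).tensor r (lineModule r α w)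

theorem isHomogeneous_truncExp (r N : ℕ) (c : ℕ → ℂ) (α β : ℂ) :
    IsHomogeneous ((verma r α).tensor r (verma r β)).wt ((verma r α).tensor r (verma r β)).wt 0
      (truncExp N c (opE r α) (opF r)) := by
  refine IsHomogeneous.sum fun k _ => IsHomogeneous.smul ?_ _
  have h := ((isHomogeneous_opE r α).pow k).kronecker ((isHomogeneous_opF r β).pow k)
  rwa [smul_neg, add_neg_cancel] at h

theorem verma_tensor_swap_wt (r : ℕ) (α β : ℂ) :
    ((verma r β).tensor r (verma r α)).wt = ((verma r α).tensor r (verma r β)).wt ∘ Prod.swap :=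
  funext fun _ => add_comm _ _

theorem verma_tensor_swap_E (r : ℕ) (α β : ℂ) :
    ((verma r β).tensor r (verma r α)).E =
      (opE r α ⊗ₖ 1 + opK r 1 α ⊗ₖ opE r β).submatrix Prod.swap Prod.swap := by
  have h : ((verma r β).tensor r (verma r α)).E = opE r β ⊗ₖ opK r 1 α + 1 ⊗ₖ opE r α := rfl
  rw [h]
  ext ⟨a, b⟩ ⟨a', b'⟩
  simp only [Matrix.add_apply, Matrix.kroneckerMap_apply, Matrix.submatrix_apply, Prod.swap]
  ring

theorem isHom_braiding {r : ℕ} (hr : 2 ≤ r) (α β : ℂ) :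
    ((verma r α).tensor r (verma r β)).IsHom ((verma r β).tensor r (verma r α))
      (braiding r α β) where
  homogeneous b a h := by
    rw [verma_tensor_swap_wt r α β]
    exact ((IsHomogeneous.diagonal _ _).mul (isHomogeneous_truncExp r r (rCoeff r) α β) h).trans
      (congrArg _ (add_zero 0))
  mul_E := by
    have h : opR r α β * ((verma r α).tensor r (verma r β)).E = _ := opR_mul hr α β
    rw [verma_tensor_swap_E r α β]
    exact (congrArg (Matrix.submatrix · Prod.swap id) h).trans
      (Matrix.submatrix_mul_equiv _ _ _ (Equiv.prodComm _ _) _).symm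

theorem isHom_braidingInv {r : ℕ} (hr : 2 ≤ r) (α β : ℂ) :
    ((verma r α).tensor r (verma r β)).IsHom ((verma r β).tensor r (verma r α))
      (braidingInv r α β) where
  homogeneous b a h := by
    rw [verma_tensor_swap_wt r β α]
    exact ((isHomogeneous_truncExp r r (rInvCoeff r) β α).mul (IsHomogeneous.diagonal _ _) h).trans
      (congrArg _ (add_zero 0))
  mul_E := by
    have h : _ = ((verma r β).tensor r (verma r α)).E * opRInv r β α := opRInv_mul hr β α
    rw [verma_tensor_swap_E r β α]
    exact (Matrix.submatrix_mul_equiv _ _ _ (Equiv.prodComm _ _) _).trans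
      (congrArg (Matrix.submatrix · id Prod.swap) h)

theorem opE_mul_zeta_weight {r : ℕ} (hr : r ≠ 0) (α : ℂ) (k : ℤ) (a b : Fin r) :
    opE r α a b * zeta r (r * k * weight α a) = opE r α a b * zeta r (r * k * weight α b) := by
  by_cases h : opE r α a b = 0
  · rw [h, zero_mul, zero_mul]
  · rw [isHomogeneous_opE r α h, ← zeta_add_two_mul_mul_intCast hr (r * k * weight α b) k]
    ring_nf

theorem isHom_cupR (r : ℕ) (α : ℂ) :
    unit.IsHom ((verma r α).tensor r (vermaDual r α))
      (Matrix.of fun (p : Fin r × Fin r) _ => if p.1 = p.2 then 1 else 0) := by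
  refine IsHom.cup (g := fun _ => 1) (fun a => add_neg_cancel _) fun a b => ?_
  rw [mul_one, mul_one, vermaDual_E_apply]
  exact add_neg_cancel _

theorem isHom_capR (r : ℕ) (α : ℂ) :
    ((vermaDual r α).tensor r (verma r α)).IsHom unit
      (Matrix.of fun _ (p : Fin r × Fin r) => if p.1 = p.2 then 1 else 0) := by
  refine IsHom.cap (g := fun _ => 1) (fun a => neg_add_cancel _) fun a b => ?_
  rw [one_mul, one_mul, vermaDual_E_apply, neg_mul, mul_assoc, zeta_neg]
  simp only [verma, inv_mul_cancel₀ (zeta_ne_zero r _), mul_one, neg_add_cancel]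

theorem isHom_cupL {r : ℕ} (hr : r ≠ 0) (α : ℂ) :
    unit.IsHom ((vermaDual r α).tensor r (verma r α))
      (Matrix.of fun (p : Fin r × Fin r) _ => if p.1 = p.2 then eigK r α (r - 1) p.1 else 0) := by
  refine IsHom.cup (fun a => neg_add_cancel _) fun a b => ?_
  have h := opE_mul_zeta_weight hr α 1 b a
  have e (x : ℂ) : zeta r ((r - 1) * x) = zeta r (r * (1 : ℤ) * x) * zeta r (-x) := by
    rw [← zeta_add]
    push_cast
    ring_nf
  have hb : zeta r (-weight α b) * zeta r (weight α b) = 1 := by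
    rw [← zeta_add, neg_add_cancel, zeta_zero]
  simp only [vermaDual_E_apply, verma, eigK, e]
  linear_combination (-zeta r (-weight α a)) * h -
    opE r α b a * zeta r (-weight α a) * zeta r (r * (1 : ℤ) * weight α b) * hb

theorem isHom_capL {r : ℕ} (hr : r ≠ 0) (α : ℂ) :
    ((verma r α).tensor r (vermaDual r α)).IsHom unit
      (Matrix.of fun _ (p : Fin r × Fin r) => if p.1 = p.2 then eigK r α (1 - r) p.1 else 0) := by
  refine IsHom.cap (fun a => add_neg_cancel _) fun a b => ?_
  have h := opE_mul_zeta_weight hr α (-1) b a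
  have e (x : ℂ) : zeta r (r * (-1 : ℤ) * x) = zeta r ((1 - r) * x) * zeta r (-x) := by
    rw [← zeta_add]
    push_cast
    ring_nf
  rw [e, e] at h
  rw [vermaDual_E_apply]
  simp only [verma, vermaDual, eigK]
  linear_combination h

/-! ### The functor on layers and diagrams -/

theorem mul_one_apply {R S : Type*} [MulZeroOneClass R] [DecidableEq S] (x : R) (t s : S) :
    x * (1 : Matrix S S R) t s = if t = s then x else 0 := by
  rw [Matrix.one_apply, mul_ite, mul_one, mul_zero]

theorem Layer.isHom_matrix {n r : ℕ} (hr : 2 ≤ r) (α : Fin n → ℂ) {v w : List (Strand n)}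
    (s : Layer n v w) : (lineModule r α v).IsHom (lineModule r α w) (s.matrix r α) := by
  have hr0 : r ≠ 0 := by omega
  induction s with
  | pos i j w =>
    exact ((isHom_braiding hr (α i) (α j)).tensor_left (lineModule r α w)).of_forall_apply_eq
      fun ⟨_, _, t⟩ ⟨_, _, s⟩ => (mul_one_apply _ t s).symm
  | neg i j w =>
    exact ((isHom_braidingInv hr (α i) (α j)).tensor_left (lineModule r α w)).of_forall_apply_eq
      fun ⟨_, _, t⟩ ⟨_, _, s⟩ => (mul_one_apply _ t s).symm
  | cupR i w =>
    exact ((isHom_cupR r (α i)).tensor_left_of_unit (lineModule r α w)).of_forall_apply_eq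
      fun ⟨_, _, t⟩ s => (ite_and ..).trans (mul_one_apply _ t s).symm
  | cupL i w =>
    refine ((isHom_cupL hr0 (α i)).tensor_left_of_unit (lineModule r α w)).of_forall_apply_eq
      fun ⟨a, b, t⟩ s => (Eq.trans ?_ (ite_and ..)).trans (mul_one_apply _ t s).symm
    exact ite_congr rfl (fun h => h.2 ▸ rfl) fun _ => rfl
  | capR i w =>
    exact ((isHom_capR r (α i)).tensor_left_to_unit (lineModule r α w)).of_forall_apply_eq
      fun t ⟨_, _, s⟩ => (ite_and ..).trans (mul_one_apply _ t s).symm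
  | capL i w =>
    exact ((isHom_capL hr0 (α i)).tensor_left_to_unit (lineModule r α w)).of_forall_apply_eq
      fun t ⟨_, _, s⟩ => (ite_and ..).trans (mul_one_apply _ t s).symm
  | skip x s ih =>
    refine (ih.one_tensor r (strandModule r α x)).of_forall_apply_eq fun ⟨a', t'⟩ ⟨a, t⟩ => ?_
    exact (mul_one_apply _ a' a).symm.trans (mul_comm _ _)

theorem Diagram.isHom_matrix {n r : ℕ} (hr : 2 ≤ r) (α : Fin n → ℂ) {v w : List (Strand n)}
    (D : Diagram n v w) : (lineModule r α v).IsHom (lineModule r α w) (D.matrix r α) := by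
  induction D with
  | nil v => exact .one _
  | cons s D ih => exact ih.mul (s.isHom_matrix hr α)

theorem Diagram.exists_matrix_eq_mul {n r : ℕ} (hr : 2 ≤ r) (α : Fin n → ℂ)
    {v w : List (Strand n)} (D : Diagram n v w) {l : List (Strand n)} (hl : l ∈ D.lines) :
    ∃ (A : Matrix (State r w) (State r l) ℂ) (B : Matrix (State r l) (State r v) ℂ),
      (lineModule r α l).IsHom (lineModule r α w) A ∧
      (lineModule r α v).IsHom (lineModule r α l) B ∧ D.matrix r α = A * B := by
  induction D with
  | nil v =>
    obtain rfl := List.mem_singleton.1 hl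
    exact ⟨1, 1, .one _, .one _, by rw [Diagram.matrix, one_mul]⟩
  | cons s D ih =>
    rcases List.mem_cons.1 hl with rfl | hl
    · exact ⟨_, 1, (Diagram.cons s D).isHom_matrix hr α, .one _, by rw [Matrix.mul_one]⟩
    · obtain ⟨A, B, hA, hB, h⟩ := ih hl
      exact ⟨A, B * s.matrix r α, hA, hB.mul (s.isHom_matrix hr α), by
        rw [Diagram.matrix, h, Matrix.mul_assoc]⟩

/-! ### Iterated twisted commutators -/

theorem prod_sub_pow_succ_mul_eq_geom_sum₂ {R : Type*} [CommRing R] [IsDomain R] {p : R} {r : ℕ}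
    (hp : IsPrimitiveRoot p r) (hr : 0 < r) {x y : R} (hxy : x ≠ y) :
    ∏ s ∈ Finset.range (r - 1), (x - p ^ (s + 1) * y) =
      ∑ j ∈ Finset.range r, x ^ j * y ^ (r - 1 - j) := by
  obtain ⟨m, rfl⟩ : ∃ m, r = m + 1 := ⟨r - 1, by omega⟩
  have h := congrArg (Polynomial.eval x) (X_pow_sub_C_eq_prod hp hr (rfl : y ^ (m + 1) = _))
  rw [Finset.prod_range_succ', Polynomial.eval_mul, Polynomial.eval_prod] at h
  simp only [Polynomial.eval_sub, Polynomial.eval_pow, Polynomial.eval_X, Polynomial.eval_C,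
    pow_zero, one_mul, mul_comm _ (x - y)] at h
  refine mul_left_cancel₀ (sub_ne_zero.2 hxy) ?_
  rw [(Commute.all x y).mul_geom_sum₂, h, Nat.add_sub_cancel]

section

open Polynomial

variable {𝕜 A : Type*} [Field 𝕜] [Ring A] [Algebra 𝕜 A]

/-- The iterated twisted commutators of `E` with `h`, with twists `p, p ^ 2, …`. -/
def twistedCommutator (p : 𝕜) (E h : A) : ℕ → A
  | 0 => h
  | t + 1 => E * twistedCommutator p E h t - p ^ (t + 1) • (twistedCommutator p E h t * E)

variable (𝕜) in
/-- The action of `𝕜[x, y]` on `A` where `x` and `y` are the left and the right multiplication by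
`E`. -/
def mulLeftRightHom (E : A) : 𝕜[X][X] →+* Module.End 𝕜 A :=
  eval₂RingHom' ((Algebra.lmul 𝕜 A).comp (aeval E)).toRingHom (LinearMap.mulRight 𝕜 E)
    fun f => LinearMap.commute_mulLeft_right (aeval E f) E

theorem mulLeftRightHom_C_apply (E : A) (f : 𝕜[X]) (h : A) :
    mulLeftRightHom 𝕜 E (C f) h = aeval E f * h :=
  LinearMap.congr_fun (eval₂_C _ _) h

theorem mulLeftRightHom_X_apply (E h : A) : mulLeftRightHom 𝕜 E X h = h * E :=
  LinearMap.congr_fun (eval₂_X _ _) h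

theorem twistedCommutator_eq_mulLeftRightHom (p : 𝕜) (E h : A) (t : ℕ) :
    twistedCommutator p E h t =
      mulLeftRightHom 𝕜 E (∏ s ∈ Finset.range t, (C X - C (C p) ^ (s + 1) * X)) h := by
  induction t with
  | zero => rw [Finset.prod_range_zero, map_one]; rfl
  | succ t ih =>
    rw [twistedCommutator, ih, Finset.prod_range_succ_comm, map_mul, Module.End.mul_apply,
      map_sub, map_mul, LinearMap.sub_apply, Module.End.mul_apply, ← map_pow, ← map_pow,
      mulLeftRightHom_C_apply, mulLeftRightHom_C_apply, mulLeftRightHom_X_apply,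
      aeval_X, aeval_C, ← Algebra.smul_def]

theorem twistedCommutator_pred_eq_sum {p : 𝕜} {r : ℕ} (hp : IsPrimitiveRoot p r) (hr : 0 < r)
    (E h : A) :
    twistedCommutator p E h (r - 1) = ∑ j ∈ Finset.range r, E ^ j * h * E ^ (r - 1 - j) := by
  have hp' : IsPrimitiveRoot (C (C p)) r :=
    (hp.map_of_injective C_injective).map_of_injective C_injective
  have hXY : C (X : 𝕜[X]) ≠ X := fun h => by simpa using congrArg natDegree h
  rw [twistedCommutator_eq_mulLeftRightHom, prod_sub_pow_succ_mul_eq_geom_sum₂ hp' hr hXY,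
    map_sum, LinearMap.sum_apply]
  refine Finset.sum_congr rfl fun j _ => ?_
  have hX (k : ℕ) (g : A) : mulLeftRightHom 𝕜 E (X ^ k) g = g * E ^ k := by
    induction k with
    | zero => rw [pow_zero, pow_zero, map_one, mul_one, Module.End.one_apply]
    | succ k ih => rw [pow_succ', map_mul, Module.End.mul_apply, ih, mulLeftRightHom_X_apply,
        mul_assoc, pow_succ]
  rw [map_mul, Module.End.mul_apply, hX, ← map_pow, mulLeftRightHom_C_apply, map_pow,
    aeval_X, mul_assoc]

end

/-! ### Contractible modules -/

theorem isPrimitiveRoot_zeta_two {r : ℕ} (hr : r ≠ 0) : IsPrimitiveRoot (zeta r 2) r := by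
  convert Complex.isPrimitiveRoot_exp r hr using 1
  rw [zeta]
  ring_nf

theorem isPrimitiveRoot_zeta_neg_two {r : ℕ} (hr : r ≠ 0) : IsPrimitiveRoot (zeta r (-2)) r := by
  rw [zeta_neg]
  exact (isPrimitiveRoot_zeta_two hr).inv

theorem IsHomogeneous.twistedCommutator {𝕜 Γ S : Type*} [Field 𝕜] [AddCommGroup Γ] [Fintype S]
    [DecidableEq S] {wt : S → Γ} {d e : Γ} {E h : Matrix S S 𝕜} (hE : IsHomogeneous wt wt e E)
    (hh : IsHomogeneous wt wt d h) (p : 𝕜) (t : ℕ) :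
    IsHomogeneous wt wt (d + t • e) (twistedCommutator p E h t) := by
  induction t with
  | zero => rwa [zero_nsmul, add_zero]
  | succ t ih =>
    have hr := (ih.mul hE).smul (-p ^ (t + 1))
    have hl := hE.mul ih
    rw [succ_nsmul, ← add_assoc, ADO.twistedCommutator, sub_eq_add_neg, ← neg_smul]
    rw [add_comm] at hr
    exact hl.add hr

namespace BorelModule

/-- The identity of `M` is of the form `∑ E ^ j h E ^ (r - 1 - j)`, with `h` lowering weights by
`2 (r - 1)`. Every map factoring through such a module is zero on the kernel of `E`, modulo the
image of `E ^ (r - 1)`. -/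
def Contractible {S : Type*} [Fintype S] [DecidableEq S] (r : ℕ) (M : BorelModule S) : Prop :=
  ∃ h : Matrix S S ℂ, IsHomogeneous M.wt M.wt (-(2 * (r - 1))) h ∧
    ∑ j ∈ Finset.range r, M.E ^ j * h * M.E ^ (r - 1 - j) = 1

variable {S T : Type*} [Fintype S] [DecidableEq S] [Fintype T] [DecidableEq T] {r : ℕ}

theorem twistedCommutator_tensor_one_kronecker (hr : r ≠ 0) (M : BorelModule S) (N : BorelModule T)
    {h : Matrix T T ℂ} (hh : IsHomogeneous N.wt N.wt (-(2 * (r - 1))) h) (t : ℕ) :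
    twistedCommutator (zeta r 2) (M.tensor r N).E (1 ⊗ₖ h) t =
      1 ⊗ₖ twistedCommutator (zeta r 2) N.E h t := by
  induction t with
  | zero => rfl
  | succ t ih =>
    set g := twistedCommutator (zeta r 2) N.E h t with hg
    have hK : N.K r 1 * g = zeta r 2 ^ (t + 1) • (g * N.K r 1) := by
      have h0 := (N.isHomogeneous_E.twistedCommutator hh (zeta r 2) t).diagonal_zeta_mul r 1
      have e : 1 * (-(2 * ((r : ℂ) - 1)) + t • 2) = (t + 1 : ℕ) * 2 + 2 * r * (-1 : ℤ) := by
        push_cast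
        ring
      rwa [e, zeta_add_two_mul_mul_intCast hr, zeta_nat_mul] at h0
    have hE : (M.tensor r N).E = M.E ⊗ₖ N.K r 1 + 1 ⊗ₖ N.E := rfl
    rw [twistedCommutator, twistedCommutator, ih, hE, ← hg]
    simp only [Matrix.add_mul, Matrix.mul_add, ← Matrix.mul_kronecker_mul, Matrix.one_mul,
      Matrix.mul_one, hK, Matrix.kronecker_smul, sub_eq_add_neg, ← neg_smul, Matrix.kronecker_add]
    module

theorem twistedCommutator_tensor_kronecker_K (hr : r ≠ 0) (M : BorelModule S) (N : BorelModule T)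
    (h : Matrix S S ℂ) (t : ℕ) :
    twistedCommutator (zeta r (-2)) (M.tensor r N).E (h ⊗ₖ N.K r (-(r - 1))) t =
      twistedCommutator (zeta r (-2)) M.E h t ⊗ₖ N.K r (-(r - 1) + t) := by
  induction t with
  | zero => rw [Nat.cast_zero, add_zero]; rfl
  | succ t ih =>
    set g := twistedCommutator (zeta r (-2)) M.E h t with hg
    set s : ℂ := -(r - 1) + t with hs
    have hKE : zeta r (-2) ^ (t + 1) • (N.K r s * N.E) = N.E * N.K r s := by
      have e : (t + 1 : ℕ) * (-2) + s * 2 = 2 * r * (-1 : ℤ) := by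
        rw [hs]
        push_cast
        ring
      rw [K_mul_E, smul_smul, ← zeta_nat_mul, ← zeta_add, e, zeta_two_mul_mul_intCast hr, one_smul]
    have hs1 : -((r : ℂ) - 1) + (t + 1 : ℕ) = s + 1 := by rw [Nat.cast_succ, ← add_assoc]
    have hE : (M.tensor r N).E = M.E ⊗ₖ N.K r 1 + 1 ⊗ₖ N.E := rfl
    rw [twistedCommutator, twistedCommutator, ih, hE, ← hg, hs1]
    simp only [Matrix.add_mul, Matrix.mul_add, ← Matrix.mul_kronecker_mul, Matrix.one_mul,
      Matrix.mul_one, ← hKE, ← K_add, add_comm 1 s, Matrix.kronecker_smul, sub_eq_add_neg,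
      ← neg_smul, Matrix.add_kronecker, Matrix.smul_kronecker]
    module

theorem Contractible.tensor_left (hr : r ≠ 0) {N : BorelModule T} (hN : N.Contractible r)
    (M : BorelModule S) : (M.tensor r N).Contractible r := by
  obtain ⟨h, hh, h1⟩ := hN
  have hr' := Nat.pos_of_ne_zero hr
  have hp := isPrimitiveRoot_zeta_two hr
  refine ⟨1 ⊗ₖ h, ?_, ?_⟩
  · have h' := (IsHomogeneous.one (R := ℂ) M.wt).kronecker hh
    rwa [zero_add] at h'
  · rw [← twistedCommutator_pred_eq_sum hp hr', twistedCommutator_tensor_one_kronecker hr M N hh,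
      twistedCommutator_pred_eq_sum hp hr', h1, Matrix.one_kronecker_one]

theorem Contractible.tensor_right (hr : r ≠ 0) {M : BorelModule S} (hM : M.Contractible r)
    (N : BorelModule T) : (M.tensor r N).Contractible r := by
  obtain ⟨h, hh, h1⟩ := hM
  have hr' := Nat.pos_of_ne_zero hr
  have hp := isPrimitiveRoot_zeta_neg_two hr
  have hK : N.K r (-(r - 1) + (r - 1 : ℕ)) = 1 := by
    rw [Nat.cast_pred hr', neg_add_cancel, K_zero]
  refine ⟨h ⊗ₖ N.K r (-(r - 1)), ?_, ?_⟩
  · have h' := hh.kronecker (IsHomogeneous.diagonal N.wt fun a => zeta r (-(r - 1) * N.wt a))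
    rwa [add_zero] at h'
  · rw [← twistedCommutator_pred_eq_sum hp hr', twistedCommutator_tensor_kronecker_K hr,
      twistedCommutator_pred_eq_sum hp hr', h1, hK, Matrix.one_kronecker_one]

end BorelModule

theorem BorelModule.Contractible.mulVec_eq_zero {S T U : Type*} [Fintype S] [Fintype T]
    [DecidableEq T] [Fintype U] [DecidableEq U] {r : ℕ} {L : BorelModule S}
    {M : BorelModule T} {N : BorelModule U} (hM : M.Contractible r) {A : Matrix U T ℂ}
    {B : Matrix T S ℂ} (hA : M.IsHom N A) (hB : L.IsHom M B) (hN : N.E ^ (r - 1) = 0) {x : S → ℂ}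
    (hx : L.E.mulVec x = 0) : (A * B).mulVec x = 0 := by
  obtain ⟨h, -, h1⟩ := hM
  have hBx : M.E.mulVec (B.mulVec x) = 0 := by
    rw [Matrix.mulVec_mulVec, ← hB.mul_E, ← Matrix.mulVec_mulVec, hx, Matrix.mulVec_zero]
  have hAE (k : ℕ) : A * M.E ^ k = N.E ^ k * A := by
    induction k with
    | zero => rw [pow_zero, pow_zero, Matrix.mul_one, Matrix.one_mul]
    | succ k ih =>
      rw [pow_succ, ← Matrix.mul_assoc, ih, Matrix.mul_assoc, hA.mul_E, ← Matrix.mul_assoc,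
        pow_succ]
  have hterm : ∀ j ∈ Finset.range r,
      (A * (M.E ^ j * h * M.E ^ (r - 1 - j))).mulVec (B.mulVec x) = 0 := by
    intro j hj
    rcases eq_or_ne j (r - 1) with rfl | hne
    · rw [Matrix.mul_assoc, ← Matrix.mul_assoc, hAE, hN, Matrix.zero_mul, Matrix.zero_mul,
        Matrix.zero_mulVec]
    · obtain ⟨k, hk⟩ : ∃ k, r - 1 - j = k + 1 :=
        ⟨r - 2 - j, by have := Finset.mem_range.1 hj; omega⟩
      rw [hk, pow_succ, ← Matrix.mul_assoc, ← Matrix.mul_assoc, ← Matrix.mulVec_mulVec, hBx,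
        Matrix.mulVec_zero]
  rw [← Matrix.mulVec_mulVec, ← Matrix.mul_one A, ← h1, Matrix.mul_sum, Matrix.sum_mulVec]
  exact Finset.sum_eq_zero hterm

theorem sum_superdiagonal_pow_mul_single_mul_pow {R : Type*} [CommSemiring R] (m : ℕ) (ε : ℕ → R) :
    ∑ j ∈ Finset.range (m + 1), superdiagonal (m + 1) ε ^ j * Matrix.single (Fin.last m) 0 1 *
        superdiagonal (m + 1) ε ^ (m - j) =
      (∏ i ∈ Finset.range m, ε (i + 1)) • (1 : Matrix (Fin (m + 1)) (Fin (m + 1)) R) := by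
  ext k i
  have hterm (j : ℕ) (hj : j ∈ Finset.range (m + 1)) :
      (superdiagonal (m + 1) ε ^ j * Matrix.single (Fin.last m) 0 (1 : R) *
        superdiagonal (m + 1) ε ^ (m - j) : Matrix _ _ R) k i =
      if j = m - k then if k = i then ∏ i ∈ Finset.range m, ε (i + 1) else 0 else 0 := by
    rw [Matrix.single_eq_single_vecMulVec_single, Matrix.mul_vecMulVec, Matrix.vecMulVec_mul,
      Matrix.mulVec_single_one, Matrix.single_one_vecMul, Matrix.vecMulVec_apply]
    simp only [Matrix.col_apply, Matrix.row_apply, superdiagonal_pow_apply, Fin.val_last,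
      Fin.val_zero, zero_add]
    have hj' : j ≤ m := Nat.lt_succ_iff.1 (Finset.mem_range.1 hj)
    by_cases hk : j = m - k
    · rw [if_pos (by omega), if_pos hk]
      by_cases hki : k = i
      · have hprod := Finset.prod_range_add (fun x => ε (x + 1)) k j
        rw [show (k : ℕ) + j = m by omega] at hprod
        rw [if_pos (by omega), if_pos hki, hprod, mul_comm, show m - j = k by omega]
      · rw [if_neg (by omega), if_neg hki, mul_zero]
    · rw [if_neg (by omega), if_neg hk, zero_mul]
  rw [Matrix.sum_apply, Finset.sum_congr rfl hterm, Finset.sum_ite_eq', if_pos, Matrix.smul_apply,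
    Matrix.one_apply, smul_eq_mul, mul_ite, mul_one, mul_zero]
  exact Finset.mem_range.2 (by omega)

theorem qInt_add_intCast_ne_zero {r : ℕ} (hr : r ≠ 0) {α : ℂ} (hα : α ∉ integers) (k : ℤ) :
    qInt r (α + k) ≠ 0 := by
  rw [Ne, qInt_eq_zero_iff hr]
  rintro ⟨m, hm⟩
  refine hα ⟨r * m - k, ?_⟩
  push_cast
  linear_combination -hm

theorem qInt_sub_natCast_add_one_div_qInt_one_ne_zero {r : ℕ} (hr : 2 ≤ r) {α : ℂ}
    (hα : α ∉ integers) (i : ℕ) : qInt r (α - i + 1) / qInt r 1 ≠ 0 := by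
  have h := qInt_add_intCast_ne_zero (r := r) (by omega) hα (1 - i)
  refine div_ne_zero ?_ (qInt_one_ne_zero hr)
  convert h using 2
  push_cast
  ring

theorem exists_sum_superdiagonal_pow_mul_mul_pow_eq_one {𝕜 : Type*} [Field 𝕜] (m : ℕ) {ε : ℕ → 𝕜}
    (hε : ∀ i, ε i ≠ 0) :
    ∃ z : 𝕜, ∑ j ∈ Finset.range (m + 1), superdiagonal (m + 1) ε ^ j *
      Matrix.single (Fin.last m) 0 z * superdiagonal (m + 1) ε ^ (m - j) = 1 := by
  refine ⟨(∏ i ∈ Finset.range m, ε (i + 1))⁻¹, ?_⟩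
  have h0 : ∏ i ∈ Finset.range m, ε (i + 1) ≠ 0 := Finset.prod_ne_zero_iff.2 fun i _ => hε _
  have hsmul : Matrix.single (Fin.last m) (0 : Fin (m + 1)) (∏ i ∈ Finset.range m, ε (i + 1))⁻¹ =
      (∏ i ∈ Finset.range m, ε (i + 1))⁻¹ • Matrix.single (Fin.last m) 0 1 := by
    rw [Matrix.smul_single, smul_eq_mul, mul_one]
  simp only [hsmul, Matrix.mul_smul, Matrix.smul_mul, ← Finset.smul_sum]
  rw [sum_superdiagonal_pow_mul_single_mul_pow, inv_smul_smul₀ h0]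

theorem IsHomogeneous.single {Γ R S T : Type*} [AddCommMonoid Γ] [Semiring R] [DecidableEq S]
    [DecidableEq T] {wt : S → Γ} {wt' : T → Γ} {d : Γ} {b : T} {a : S} (h : wt' b = wt a + d)
    (z : R) : IsHomogeneous wt wt' d (Matrix.single b a z) := by
  intro b' a' hne
  obtain ⟨rfl, rfl⟩ : b = b' ∧ a = a' := by
    by_contra hba
    exact hne (Matrix.single_apply_of_ne _ _ _ _ _ hba)
  exact h

theorem contractible_verma {r : ℕ} (hr : 2 ≤ r) {α : ℂ} (hα : α ∉ integers) :
    (verma r α).Contractible r := by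
  obtain ⟨m, rfl⟩ : ∃ m, r = m + 1 := ⟨r - 1, by omega⟩
  obtain ⟨z, hz⟩ := exists_sum_superdiagonal_pow_mul_mul_pow_eq_one m
    (qInt_sub_natCast_add_one_div_qInt_one_ne_zero hr hα)
  refine ⟨_, .single (b := Fin.last m) (a := 0) ?_ z, hz⟩
  simp only [verma, weight, Fin.val_last, Fin.val_zero]
  push_cast
  ring

theorem vermaDual_E_eq_transpose_superdiagonal (r : ℕ) (α : ℂ) :
    (vermaDual r α).E = (superdiagonal r fun i =>
      -(qInt r (α - i + 1) / qInt r 1 * zeta r (-(α - 2 * i)))).transpose := by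
  ext b a
  rw [vermaDual_E_apply, Matrix.transpose_apply, opE_eq_superdiagonal, superdiagonal_apply,
    superdiagonal_apply]
  split_ifs
  · rfl
  · rw [zero_mul, neg_zero]

theorem contractible_vermaDual {r : ℕ} (hr : 2 ≤ r) {α : ℂ} (hα : α ∉ integers) :
    (vermaDual r α).Contractible r := by
  obtain ⟨m, rfl⟩ : ∃ m, r = m + 1 := ⟨r - 1, by omega⟩
  obtain ⟨z, hz⟩ := exists_sum_superdiagonal_pow_mul_mul_pow_eq_one m (ε := fun i =>
      -(qInt (m + 1) (α - i + 1) / qInt (m + 1) 1 * zeta (m + 1) (-(α - 2 * i)))) fun i =>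
    neg_ne_zero.2 (mul_ne_zero (qInt_sub_natCast_add_one_div_qInt_one_ne_zero hr hα i)
      (zeta_ne_zero _ _))
  refine ⟨_, .single (b := 0) (a := Fin.last m) ?_ z, ?_⟩
  · simp only [vermaDual, weight, Fin.val_last, Fin.val_zero]
    push_cast
    ring
  · have h := congrArg Matrix.transpose hz
    simp only [Matrix.transpose_sum, Matrix.transpose_mul, Matrix.transpose_pow,
      Matrix.transpose_single, Matrix.transpose_one, ← vermaDual_E_eq_transpose_superdiagonal] at h
    rw [← h, ← Finset.sum_range_reflect]
    refine Finset.sum_congr rfl fun j hj => ?_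
    rw [Nat.add_sub_cancel, Nat.sub_sub_self (Nat.lt_succ_iff.1 (Finset.mem_range.1 hj)),
      Matrix.mul_assoc]

theorem contractible_lineModule {n r : ℕ} (hr : 2 ≤ r) (α : Fin n → ℂ) {w : List (Strand n)}
    {x : Strand n} (hx : x ∈ w) (hα : α x.comp ∉ integers) : (lineModule r α w).Contractible r := by
  induction w with
  | nil => exact absurd hx List.not_mem_nil
  | cons y w ih =>
    rcases List.mem_cons.1 hx with rfl | hx
    · cases x with
      | down i => exact (contractible_verma hr hα).tensor_right (by omega) (lineModule r α w)
      | up i => exact (contractible_vermaDual hr hα).tensor_right (by omega) (lineModule r α w)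
    · exact (ih hx).tensor_left (by omega) (strandModule r α y)

/-! ### The scalar of a (1,1)-tangle -/

/-- The inverse of the modified dimension. -/
def modifiedDimInv (r : ℕ) (z : ℂ) : ℂ := ∏ j ∈ Finset.range (r - 1), qInt r (z + r - j)

theorem modifiedDim_eq_inv_modifiedDimInv (r : ℕ) (z : ℂ) :
    modifiedDim r z = (modifiedDimInv r z)⁻¹ := by
  simp only [modifiedDim, modifiedDimInv, qInt, one_div, Finset.prod_inv_distrib]

theorem modifiedDimInv_add_two_mul_mul_intCast {r : ℕ} (hr : r ≠ 0) (z : ℂ) (k : ℤ) :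
    modifiedDimInv r (z + 2 * r * k) = modifiedDimInv r z := by
  refine Finset.prod_congr rfl fun j _ => ?_
  rw [← qInt_add_two_mul_mul_intCast hr (z + r - j) k]
  congr 1
  ring

theorem qInt_add_natCast_self_sub_eq_zero_iff {r : ℕ} (hr : r ≠ 0) (z : ℂ) (j : ℕ) :
    qInt r (z + r - j) = 0 ↔ ∃ k : ℤ, z = j + r * k := by
  rw [qInt_eq_zero_iff hr]
  refine (Equiv.addRight (-1 : ℤ)).exists_congr fun k => ?_
  rw [Equiv.coe_addRight, Int.cast_add, Int.cast_neg, Int.cast_one]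
  constructor <;> intro h <;> linear_combination h

theorem modifiedDimInv_eq_zero_iff {r : ℕ} (hr : r ≠ 0) (z : ℂ) :
    modifiedDimInv r z = 0 ↔ ∃ j < r - 1, ∃ k : ℤ, z = j + r * k := by
  simp only [modifiedDimInv, Finset.prod_eq_zero_iff, Finset.mem_range,
    qInt_add_natCast_self_sub_eq_zero_iff hr]

theorem modifiedDimInv_ne_zero {r : ℕ} (hr : r ≠ 0) {z : ℂ} (hz : z ∉ integers) :
    modifiedDimInv r z ≠ 0 := by
  rw [Ne, modifiedDimInv_eq_zero_iff hr]
  rintro ⟨j, -, k, rfl⟩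
  exact hz ⟨j + r * k, by push_cast; ring⟩

theorem opE_mulVec_single_zero (r : ℕ) [NeZero r] (α : ℂ) :
    (opE r α).mulVec (Pi.single 0 1) = 0 := by
  ext b
  simp [opE_eq_superdiagonal, superdiagonal_apply]

theorem opE_pow_pred_eq_zero {r : ℕ} (hr : r ≠ 0) {α : ℂ} (hα : modifiedDimInv r α = 0) :
    opE r α ^ (r - 1) = 0 := by
  obtain ⟨j, hj, k, rfl⟩ := (modifiedDimInv_eq_zero_iff hr α).1 hα
  ext b a
  rw [opE_eq_superdiagonal, superdiagonal_pow_apply, Matrix.zero_apply]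
  split_ifs with hba
  · have hb : (b : ℕ) = 0 := by omega
    refine Finset.prod_eq_zero (Finset.mem_range.2 hj) (div_eq_zero_iff.2 (.inl ?_))
    rw [qInt_eq_zero_iff hr, hb]
    refine ⟨k, ?_⟩
    push_cast
    ring
  · rfl

theorem eq_smul_one_of_mul_superdiagonal_eq {R : Type*} [CommRing R] [IsDomain R] {r : ℕ}
    [NeZero r] {ε : ℕ → R} (hε : ∀ i, ε i ≠ 0) {A : Matrix (Fin r) (Fin r) R}
    (hA : ∀ b a, A b a ≠ 0 → b = a) (h : A * superdiagonal r ε = superdiagonal r ε * A) :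
    A = A 0 0 • 1 := by
  have hdiag : A = Matrix.diagonal fun a => A a a := by
    ext b a
    rw [Matrix.diagonal_apply]
    split_ifs with hba
    · rw [hba]
    · exact by_contra fun h0 => hba (hA b a h0)
  have hconst : ∀ (i : ℕ) (hi : i < r), A ⟨i, hi⟩ ⟨i, hi⟩ = A 0 0 := by
    intro i
    induction i with
    | zero => exact fun _ => rfl
    | succ i ih =>
      intro hi
      have hentry := congrFun (congrFun h ⟨i, by omega⟩) ⟨i + 1, hi⟩
      rw [superdiagonal_mul_apply, dif_pos hi, hdiag, Matrix.diagonal_mul, superdiagonal_apply,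
        if_pos rfl, mul_comm, Matrix.diagonal_apply_eq] at hentry
      rw [← ih (by omega)]
      exact (mul_left_cancel₀ (hε _) hentry).symm
  calc A = Matrix.diagonal fun a => A a a := hdiag
    _ = Matrix.diagonal fun _ => A 0 0 := congrArg _ (funext fun a => hconst a a.2)
    _ = A 0 0 • 1 := (Matrix.smul_one_eq_diagonal _).symm

theorem verma_wt_eq_lineModule_wt {n : ℕ} (r : ℕ) (α : Fin n → ℂ) (c : Fin n) :
    (verma r (α c)).wt = (lineModule r α [down c]).wt ∘ (Equiv.prodPUnit (Fin r)).symm :=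
  funext fun a => (add_zero (weight (α c) a)).symm

theorem verma_E_eq_lineModule_E {n : ℕ} (r : ℕ) (α : Fin n → ℂ) (c : Fin n) :
    (verma r (α c)).E = (lineModule r α [down c]).E.submatrix (Equiv.prodPUnit (Fin r)).symm
      (Equiv.prodPUnit (Fin r)).symm := by
  ext a b
  change opE r (α c) a b = opE r (α c) a b * BorelModule.unit.K r 1 () () +
    (1 : Matrix (Fin r) (Fin r) ℂ) a b * 0
  rw [BorelModule.K, Matrix.diagonal_apply_eq, BorelModule.unit, mul_zero, mul_zero, zeta_zero,
    mul_one, add_zero]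

/-- The coefficient of the highest weight vector of `V_{α_c}` in its image under the endomorphism
attached to a (1,1)-tangle. Unlike the scalar `⟨T⟩`, it is defined for all colours. -/
def Diagram.corner {n : ℕ} (r : ℕ) [NeZero r] {c : Fin n} (T : Diagram n [down c] [down c])
    (α : Fin n → ℂ) : ℂ :=
  T.matrix r α (0, ()) (0, ())

theorem Diagram.matrix_eq_corner_smul_one {n r : ℕ} [NeZero r] (hr : 2 ≤ r) {c : Fin n}
    (T : Diagram n [down c] [down c]) {α : Fin n → ℂ} (hα : α c ∉ integers) :
    T.matrix r α = T.corner r α • 1 := by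
  set e := (Equiv.prodPUnit (Fin r)).symm
  have hhom : (verma r (α c)).IsHom (verma r (α c)) ((T.matrix r α).submatrix e e) :=
    (T.isHom_matrix hr α).submatrix e e (verma_wt_eq_lineModule_wt r α c)
      (verma_wt_eq_lineModule_wt r α c) (verma_E_eq_lineModule_E r α c)
      (verma_E_eq_lineModule_E r α c)
  have hdiag (b a : Fin r) (hba : (T.matrix r α).submatrix e e b a ≠ 0) : b = a := by
    have hwt : α c - 2 * (b : ℕ) = α c - 2 * (a : ℕ) + 0 := hhom.homogeneous hba
    have hcast : ((b : ℕ) : ℂ) = (a : ℕ) := by linear_combination -hwt / 2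
    exact Fin.ext (Nat.cast_injective hcast)
  refine (Matrix.reindex e.symm e.symm).injective ?_
  refine (eq_smul_one_of_mul_superdiagonal_eq
    (qInt_sub_natCast_add_one_div_qInt_one_ne_zero hr hα) hdiag hhom.mul_E).trans ?_
  exact (congrArg _ (Matrix.submatrix_one_equiv e)).symm

theorem Diagram.bracket_eq_of_matrix_eq_smul_one {n r : ℕ} [NeZero r] {c : Fin n}
    {T : Diagram n [down c] [down c]} {α : Fin n → ℂ} {z : ℂ} (h : T.matrix r α = z • 1) :
    T.bracket r α = z := by
  have hex : ∃ z : ℂ, T.matrix r α = z • 1 := ⟨z, h⟩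
  have : Nonempty (State r [down c]) := ⟨((0 : Fin r), ())⟩
  rw [bracket, dif_pos hex]
  exact smul_left_injective ℂ one_ne_zero (hex.choose_spec.symm.trans h)

theorem Diagram.bracket_eq_corner {n r : ℕ} [NeZero r] (hr : 2 ≤ r) {c : Fin n}
    (T : Diagram n [down c] [down c]) {α : Fin n → ℂ} (hα : α c ∉ integers) :
    T.bracket r α = T.corner r α :=
  bracket_eq_of_matrix_eq_smul_one (T.matrix_eq_corner_smul_one hr hα)

theorem Diagram.exists_mem_lines_of_compAt_eq {n : ℕ} {v w : List (Strand n)} {D : Diagram n v w}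
    {p : ℕ × ℕ} {i : Fin n} (h : D.compAt p = some i) : ∃ l ∈ D.lines, ∃ x ∈ l, x.comp = i := by
  obtain ⟨x, hx, hi⟩ := Option.map_eq_some_iff.1 h
  obtain ⟨l, hl, hxl⟩ := Option.bind_eq_some_iff.1 hx
  exact ⟨l, List.mem_of_getElem? hl, x, List.mem_of_getElem? hxl, hi⟩

theorem Diagram.corner_eq_zero_of_not_mem_integers {n r : ℕ} [NeZero r] (hr : 2 ≤ r) {c i : Fin n}
    {T : Diagram n [down c] [down c]} {p : ℕ × ℕ} (hp : T.compAt p = some i) {α : Fin n → ℂ}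
    (hi : α i ∉ integers) (hc : modifiedDimInv r (α c) = 0) : T.corner r α = 0 := by
  obtain ⟨l, hl, x, hx, rfl⟩ := exists_mem_lines_of_compAt_eq hp
  obtain ⟨A, B, hA, hB, hAB⟩ := T.exists_matrix_eq_mul hr α hl
  have hA' := hA.submatrix (Equiv.refl _) (Equiv.prodPUnit (Fin r)).symm rfl
    (verma_wt_eq_lineModule_wt r α c) rfl (verma_E_eq_lineModule_E r α c)
  have hB' := hB.submatrix (Equiv.prodPUnit (Fin r)).symm (Equiv.refl _)
    (verma_wt_eq_lineModule_wt r α c) rfl (verma_E_eq_lineModule_E r α c) rfl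
  have hzero := (contractible_lineModule hr α hx hi).mulVec_eq_zero hA' hB'
    (opE_pow_pred_eq_zero (NeZero.ne r) hc) (opE_mulVec_single_zero r (α c))
  rw [Matrix.mulVec_single_one, Matrix.submatrix_mul_equiv, ← hAB] at hzero
  exact congrFun hzero 0

/-! ### Smooth dependence on the colours -/

/-- A matrix whose entries are `k` times continuously differentiable functions of a parameter. This
is stated entrywise because matrices carry no canonical norm. -/
def EntrywiseContDiff (𝕜 : Type*) {X R S T : Type*} [NontriviallyNormedField 𝕜]
    [NormedAddCommGroup X] [NormedSpace 𝕜 X] [NormedRing R] [NormedAlgebra 𝕜 R] (k : WithTop ℕ∞)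
    (A : X → Matrix S T R) : Prop :=
  ∀ b a, ContDiff 𝕜 k fun x => A x b a

namespace EntrywiseContDiff

variable {𝕜 X R ι S T U V : Type*} [NontriviallyNormedField 𝕜] [NormedAddCommGroup X]
  [NormedSpace 𝕜 X] [NormedRing R] [NormedAlgebra 𝕜 R] {k : WithTop ℕ∞}

theorem const (A : Matrix S T R) : EntrywiseContDiff 𝕜 k fun _ : X => A := fun _ _ =>
  contDiff_const

theorem mul [Fintype T] {A : X → Matrix S T R} {B : X → Matrix T U R}
    (hA : EntrywiseContDiff 𝕜 k A) (hB : EntrywiseContDiff 𝕜 k B) :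
    EntrywiseContDiff 𝕜 k fun x => A x * B x := fun b a =>
  ContDiff.sum fun c _ => (hA b c).mul (hB c a)

theorem sum (s : Finset ι) {A : ι → X → Matrix S T R} (hA : ∀ i, EntrywiseContDiff 𝕜 k (A i)) :
    EntrywiseContDiff 𝕜 k fun x => ∑ i ∈ s, A i x := fun b a => by
  simp only [Matrix.sum_apply]
  exact ContDiff.sum fun i _ => hA i b a

theorem smul {A : X → Matrix S T R} (hA : EntrywiseContDiff 𝕜 k A) (z : R) :
    EntrywiseContDiff 𝕜 k fun x => z • A x := fun b a => contDiff_const.mul (hA b a)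

theorem kronecker {A : X → Matrix S T R} {B : X → Matrix U V R} (hA : EntrywiseContDiff 𝕜 k A)
    (hB : EntrywiseContDiff 𝕜 k B) : EntrywiseContDiff 𝕜 k fun x => A x ⊗ₖ B x := fun b a =>
  (hA b.1 a.1).mul (hB b.2 a.2)

theorem pow [Fintype S] [DecidableEq S] {A : X → Matrix S S R} (hA : EntrywiseContDiff 𝕜 k A)
    (l : ℕ) : EntrywiseContDiff 𝕜 k fun x => A x ^ l := by
  induction l with
  | zero => simpa only [pow_zero] using const 1
  | succ l ih => simpa only [pow_succ] using ih.mul hA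

end EntrywiseContDiff

section

variable {X : Type*} [NormedAddCommGroup X] [NormedSpace ℂ X] {k : WithTop ℕ∞} {f g : X → ℂ}

theorem contDiff_zeta (r : ℕ) (hf : ContDiff ℂ k f) : ContDiff ℂ k fun x => zeta r (f x) :=
  (contDiff_const.mul hf).cexp

theorem contDiff_ite {P : Prop} [Decidable P] (hf : ContDiff ℂ k f) :
    ContDiff ℂ k fun x => if P then f x else 0 := by
  split_ifs
  exacts [hf, contDiff_const]

theorem contDiff_eigK (r : ℕ) (s : ℂ) (a : Fin r) (hf : ContDiff ℂ k f) :
    ContDiff ℂ k fun x => eigK r (f x) s a :=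
  contDiff_zeta r (contDiff_const.mul (hf.sub contDiff_const))

theorem entrywiseContDiff_opE (r : ℕ) (hf : ContDiff ℂ k f) :
    EntrywiseContDiff ℂ k fun x => opE r (f x) := fun _ a =>
  have harg : ContDiff ℂ k fun x => f x - (a : ℕ) + 1 := (hf.sub contDiff_const).add contDiff_const
  contDiff_ite (((contDiff_zeta r harg).sub (contDiff_zeta r harg.neg)).div_const _)

theorem entrywiseContDiff_opHH (r : ℕ) (s : ℂ) (hf : ContDiff ℂ k f) (hg : ContDiff ℂ k g) :
    EntrywiseContDiff ℂ k fun x => opHH r s (f x) (g x) := fun b a => by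
  simp only [opHH, Matrix.diagonal_apply]
  exact contDiff_ite (contDiff_zeta r (contDiff_const.mul
    (((hf.sub contDiff_const).mul (hg.sub contDiff_const)).div_const _)))

theorem entrywiseContDiff_truncExp (r N : ℕ) (c : ℕ → ℂ) (hf : ContDiff ℂ k f) :
    EntrywiseContDiff ℂ k fun x => truncExp N c (opE r (f x)) (opF r) :=
  .sum _ fun l => (((entrywiseContDiff_opE r hf).pow l).kronecker (.const (opF r ^ l))).smul (c l)

theorem entrywiseContDiff_braiding (r : ℕ) (hf : ContDiff ℂ k f) (hg : ContDiff ℂ k g) :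
    EntrywiseContDiff ℂ k fun x => braiding r (f x) (g x) := fun _ _ =>
  (entrywiseContDiff_opHH r 1 hf hg).mul (entrywiseContDiff_truncExp r r (rCoeff r) hf) _ _

theorem entrywiseContDiff_braidingInv (r : ℕ) (hf : ContDiff ℂ k f) (hg : ContDiff ℂ k g) :
    EntrywiseContDiff ℂ k fun x => braidingInv r (f x) (g x) := fun _ _ =>
  (entrywiseContDiff_truncExp r r (rInvCoeff r) hg).mul (entrywiseContDiff_opHH r (-1) hg hf) _ _

end

theorem Layer.entrywiseContDiff_matrix {n : ℕ} (r : ℕ) (k : WithTop ℕ∞) {v w : List (Strand n)}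
    (s : Layer n v w) : EntrywiseContDiff ℂ k fun α => s.matrix r α := by
  have hα (i : Fin n) : ContDiff ℂ k fun α : Fin n → ℂ => α i := contDiff_apply ℂ ℂ i
  induction s with
  | pos i j w => exact fun _ _ => contDiff_ite (entrywiseContDiff_braiding r (hα i) (hα j) _ _)
  | neg i j w => exact fun _ _ => contDiff_ite (entrywiseContDiff_braidingInv r (hα i) (hα j) _ _)
  | cupR i w => exact .const _
  | capR i w => exact .const _
  | cupL i w => exact fun _ _ => contDiff_ite (contDiff_eigK r _ _ (hα i))
  | capL i w => exact fun _ _ => contDiff_ite (contDiff_eigK r _ _ (hα i))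
  | skip x s ih => exact fun _ _ => contDiff_ite (ih _ _)

theorem Diagram.entrywiseContDiff_matrix {n : ℕ} (r : ℕ) (k : WithTop ℕ∞) {v w : List (Strand n)}
    (D : Diagram n v w) : EntrywiseContDiff ℂ k fun α => D.matrix r α := by
  induction D with
  | nil v => exact .const _
  | cons s D ih => exact ih.mul (s.entrywiseContDiff_matrix r k)

theorem Diagram.contDiff_corner {n : ℕ} (r : ℕ) [NeZero r] (k : WithTop ℕ∞) {c : Fin n}
    (T : Diagram n [down c] [down c]) : ContDiff ℂ k (T.corner r) :=
  T.entrywiseContDiff_matrix r k _ _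

/-! ### Translation of the colours -/

theorem opE_add_two_mul_mul_intCast {r : ℕ} (hr : r ≠ 0) (α : ℂ) (k : ℤ) :
    opE r (α + 2 * r * k) = opE r α := by
  rw [opE_eq_superdiagonal, opE_eq_superdiagonal]
  congr 1
  funext i
  rw [← qInt_add_two_mul_mul_intCast hr (α - i + 1) k]
  ring_nf

theorem opHH_add_two_mul_mul_intCast {r : ℕ} (hr : r ≠ 0) (s x y : ℤ) (α β : ℂ) :
    opHH r s (α + 2 * r * x) (β + 2 * r * y) =
      zeta r (s * (r * (x * β + y * α))) • opHH r s α β := by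
  rw [opHH, opHH, ← Matrix.diagonal_smul]
  congr 1
  funext p
  rw [Pi.smul_apply, smul_eq_mul, ← zeta_add, ← zeta_add_two_mul_mul_intCast hr _
    (-(s * (r * (x * y) - x * (p.2 : ℕ) - y * (p.1 : ℕ))))]
  congr 1
  simp only [weight]
  push_cast
  ring

theorem eigK_add_two_mul_mul_intCast {r : ℕ} (hr : r ≠ 0) (s k : ℤ) (α : ℂ) (a : Fin r) :
    eigK r (α + 2 * r * k) s a = eigK r α s a := by
  rw [eigK, eigK, ← zeta_add_two_mul_mul_intCast hr (s * weight α a) (s * k)]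
  congr 1
  simp only [weight]
  push_cast
  ring

theorem braiding_add_two_mul_mul_intCast {r : ℕ} (hr : r ≠ 0) (x y : ℤ) (α β : ℂ) :
    braiding r (α + 2 * r * x) (β + 2 * r * y) =
      zeta r (r * (x * β + y * α)) • braiding r α β := by
  have h := opHH_add_two_mul_mul_intCast hr 1 x y α β
  rw [Int.cast_one, one_mul] at h
  simp only [braiding, opR, opE_add_two_mul_mul_intCast hr, h, Matrix.smul_mul,
    Matrix.submatrix_smul, Pi.smul_apply]

theorem braidingInv_add_two_mul_mul_intCast {r : ℕ} (hr : r ≠ 0) (x y : ℤ) (α β : ℂ) :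
    braidingInv r (α + 2 * r * x) (β + 2 * r * y) =
      zeta r (-(r * (x * β + y * α))) • braidingInv r α β := by
  have h := opHH_add_two_mul_mul_intCast hr (-1) y x β α
  rw [Int.cast_neg, Int.cast_one, neg_one_mul, add_comm (y * α)] at h
  simp only [braidingInv, opRInv, opE_add_two_mul_mul_intCast hr, h, Matrix.mul_smul,
    Matrix.submatrix_smul, Pi.smul_apply]

theorem sum_sum_ite_and_mul {ι κ R : Type*} [Fintype ι] [Fintype κ] [DecidableEq ι]
    [DecidableEq κ] [Ring R] (a : ι) (b : κ) (z : ℤ) (f : ι → κ → R) :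
    ∑ i, ∑ j, ((if i = a ∧ j = b then z else 0 : ℤ) : R) * f i j = z * f a b := by
  simp only [ite_and, Int.cast_ite, Int.cast_zero, ite_mul, zero_mul, Finset.sum_ite_irrel,
    Finset.sum_const_zero, Finset.sum_ite_eq', Finset.mem_univ, if_true]

theorem Layer.matrix_add_two_mul_mul_intCast {n r : ℕ} (hr : r ≠ 0) (α : Fin n → ℂ)
    (m : Fin n → ℤ) {v w : List (Strand n)} (s : Layer n v w) :
    s.matrix r (fun i => α i + 2 * r * m i) =
      zeta r (r * ∑ i, ∑ j, s.over i j * (m i * α j + m j * α i)) • s.matrix r α := by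
  induction s with
  | pos a b w =>
    ext ⟨b', a', t⟩ ⟨x, y, s⟩
    have h := congrFun (congrFun (braiding_add_two_mul_mul_intCast hr (m a) (m b) (α a) (α b))
      (b', a')) (x, y)
    simp only [Layer.over, sum_sum_ite_and_mul, Int.cast_one, one_mul]
    exact (if_congr Iff.rfl h rfl).trans (mul_ite_zero ..).symm
  | neg a b w =>
    ext ⟨b', a', t⟩ ⟨x, y, s⟩
    have h := congrFun (congrFun (braidingInv_add_two_mul_mul_intCast hr (m a) (m b) (α a) (α b))
      (b', a')) (x, y)
    simp only [Layer.over, sum_sum_ite_and_mul, Int.cast_neg, Int.cast_one, neg_one_mul, mul_neg,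
      add_comm (m b * α a)]
    exact (if_congr Iff.rfl h rfl).trans (mul_ite_zero ..).symm
  | cupR a w => simp [Layer.over, zeta_zero, Layer.matrix]
  | capR a w => simp [Layer.over, zeta_zero, Layer.matrix]
  | cupL a w =>
    have h := fun y => eigK_add_two_mul_mul_intCast hr (r - 1) (m a) (α a) y
    push_cast at h
    simp [Layer.over, zeta_zero, Layer.matrix, h]
  | capL a w =>
    have h := fun y => eigK_add_two_mul_mul_intCast hr (1 - r) (m a) (α a) y
    push_cast at h
    simp [Layer.over, zeta_zero, Layer.matrix, h]
  | skip x s ih =>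
    ext ⟨a', t'⟩ ⟨a, t⟩
    exact (if_congr Iff.rfl (congrFun (congrFun ih t') t) rfl).trans (mul_ite_zero ..).symm

theorem Diagram.matrix_add_two_mul_mul_intCast {n r : ℕ} (hr : r ≠ 0) (α : Fin n → ℂ)
    (m : Fin n → ℤ) {v w : List (Strand n)} (D : Diagram n v w) :
    D.matrix r (fun i => α i + 2 * r * m i) =
      zeta r (r * ∑ i, ∑ j, D.linking i j * (m i * α j + m j * α i)) • D.matrix r α := by
  induction D with
  | nil v => simp [Diagram.matrix, Diagram.linking, zeta_zero]
  | cons s D ih =>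
    simp only [Diagram.matrix, Diagram.linking, ih, s.matrix_add_two_mul_mul_intCast hr,
      Matrix.smul_mul, Matrix.mul_smul, smul_smul, ← zeta_add, ← mul_add, Matrix.add_apply,
      Matrix.of_apply, Int.cast_add, add_mul, Finset.sum_add_distrib]

theorem exists_eq_add_two_mul_mul_intCast_of_cover_eq {r n : ℕ} {α β : Fin n → ℂ}
    (h : cover r n α = cover r n β) : ∃ m : Fin n → ℤ, β = fun i => α i + 2 * r * m i := by
  obtain ⟨m, hm⟩ := exists_int_of_cover_eq h
  exact ⟨m, funext fun i => by linear_combination hm i⟩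

theorem Diagram.corner_eq_factor_mul {n r : ℕ} [NeZero r] {c : Fin n}
    (T : Diagram n [down c] [down c]) {α β : Fin n → ℂ} (h : cover r n α = cover r n β) :
    T.corner r β = factor r T.linking α β * T.corner r α := by
  obtain ⟨m, rfl⟩ := exists_eq_add_two_mul_mul_intCast_of_cover_eq h
  have hsymm : ∑ i, ∑ j, (T.linking i j : ℂ) * (m j * α i) =
      ∑ i, ∑ j, (T.linking i j : ℂ) * (m i * α j) := by
    rw [Finset.sum_comm]
    simp only [T.linking_comm]
  have hexp : (r : ℂ) * ∑ i, ∑ j, (T.linking i j : ℂ) * (m i * α j + m j * α i) =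
      ∑ i, ∑ j, (α i + 2 * r * m i - α i) * T.linking i j * α j := by
    simp only [mul_add, Finset.sum_add_distrib, hsymm, Finset.mul_sum]
    simp only [← Finset.sum_add_distrib]
    refine Finset.sum_congr rfl fun i _ => Finset.sum_congr rfl fun j _ => ?_
    ring
  have hentry := congrFun (congrFun (T.matrix_add_two_mul_mul_intCast (NeZero.ne r) α m) (0, ()))
    (0, ())
  rw [hexp] at hentry
  exact hentry

/-! ### Division of holomorphic functions -/

section Division

variable {E F : Type*} [NormedAddCommGroup E] [NormedSpace ℂ E] [NormedAddCommGroup F]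
  [NormedSpace ℂ F]

theorem differentiable_intervalIntegral [ProperSpace E] {G : E → ℝ → F} {G' : E → ℝ → E →L[ℂ] F}
    (hG' : Continuous (Function.uncurry G')) (hG : Continuous (Function.uncurry G))
    (h : ∀ x t, HasFDerivAt (fun y => G y t) (G' x t) x) (a b : ℝ) :
    Differentiable ℂ fun x => ∫ t in a..b, G x t := by
  intro x₀
  obtain ⟨C, hC⟩ := ((isCompact_closedBall x₀ 1).prod
    (isCompact_uIcc (a := a) (b := b))).exists_bound_of_continuousOn hG'.continuousOn
  refine (intervalIntegral.hasFDerivAt_integral_of_dominated_of_fderiv_le (F' := G')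
    (bound := fun _ => C) (Metric.closedBall_mem_nhds x₀ one_pos)
    (.of_forall fun x => (hG.comp (.prodMk_right x)).aestronglyMeasurable)
    ((hG.comp (.prodMk_right x₀)).intervalIntegrable _ _)
    (hG'.comp (.prodMk_right x₀)).aestronglyMeasurable
    (.of_forall fun t ht x hx => hC (x, t) ⟨hx, Set.uIoc_subset_uIcc ht⟩)
    intervalIntegrable_const (.of_forall fun t _ x _ => h x t)).differentiableAt

theorem differentiable_intervalIntegral_comp_add_smul [ProperSpace E] {θ : E → F}
    (hθ : ContDiff ℂ 1 θ) {L : E →L[ℂ] E} {v : E} :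
    Differentiable ℂ fun x => ∫ t in (0 : ℝ)..1, θ (x + (t - 1 : ℂ) • (L x - v)) := by
  have hpath : Continuous fun p : E × ℝ => p.1 + (p.2 - 1 : ℂ) • (L p.1 - v) := by fun_prop
  let path' : ℝ → E →L[ℂ] E := fun t => .id ℂ E + (t - 1 : ℂ) • L
  have hpath' : Continuous path' := by fun_prop
  refine differentiable_intervalIntegral
    (G' := fun x t => (fderiv ℂ θ (x + (t - 1 : ℂ) • (L x - v))).comp (path' t))
    (((hθ.continuous_fderiv one_ne_zero).comp hpath).clm_comp (hpath'.comp continuous_snd))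
    (by exact hθ.continuous.comp hpath) (fun x t => ?_) 0 1
  exact ((hθ.differentiable one_ne_zero) _).hasFDerivAt.comp x
    ((hasFDerivAt_id x).add ((L.hasFDerivAt.sub_const v).const_smul (t - 1 : ℂ)))

theorem sub_eq_intervalIntegral_fderiv [CompleteSpace F] {φ : E → F} (hφ : ContDiff ℂ 1 φ)
    (x v : E) :
    φ x - φ (x - v) = ∫ t in (0 : ℝ)..1, fderiv ℂ φ (x + (t - 1 : ℂ) • v) v := by
  have hderiv (t : ℝ) : HasDerivAt (fun t : ℝ => φ (x + (t - 1 : ℂ) • v))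
      (fderiv ℂ φ (x + (t - 1 : ℂ) • v) v) t := by
    have hpath : HasDerivAt (fun t : ℝ => x + (t - 1 : ℂ) • v) v t :=
      ((((hasDerivAt_id (t : ℂ)).comp_ofReal.sub_const 1).smul_const v).const_add x).congr_deriv
        (one_smul ℂ v)
    exact (((hφ.differentiable one_ne_zero) _).hasFDerivAt.restrictScalars ℝ).comp_hasDerivAt t
      hpath
  have hcont : Continuous fun t : ℝ => fderiv ℂ φ (x + (t - 1 : ℂ) • v) v :=
    ((hφ.continuous_fderiv one_ne_zero).comp (by fun_prop)).clm_apply continuous_const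
  rw [intervalIntegral.integral_eq_sub_of_hasDerivAt (fun t _ => hderiv t)
    (hcont.intervalIntegrable _ _)]
  simp [sub_eq_add_neg]

theorem exists_eq_sub_smul_of_eq_zero [ProperSpace E] [CompleteSpace F] {φ : E → F}
    (hφ : ContDiff ℂ 2 φ) {ℓ : E →L[ℂ] ℂ} {e : E} (he : ℓ e = 1) {m : ℂ}
    (h : ∀ x, ℓ x = m → φ x = 0) :
    ∃ ψ : E → F, Differentiable ℂ ψ ∧ ∀ x, φ x = (ℓ x - m) • ψ x := by
  have hθ : ContDiff ℂ 1 fun x => fderiv ℂ φ x e :=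
    (hφ.fderiv_right (m := 1) (by norm_num)).clm_apply contDiff_const
  refine ⟨_, differentiable_intervalIntegral_comp_add_smul hθ (L := ℓ.smulRight e) (v := m • e),
    fun x => ?_⟩
  have hzero : φ (x - (ℓ x - m) • e) = 0 := h _ (by simp [he])
  rw [← sub_zero (φ x), ← hzero, sub_eq_intervalIntegral_fderiv (hφ.of_le (by norm_num)),
    ← intervalIntegral.integral_smul]
  simp only [ContinuousLinearMap.smulRight_apply, ← sub_smul, map_smul]

/-- The quotient of `φ` by `D ∘ ℓ`, with the value dictated by l'Hôpital's rule in the direction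
`e` at the zeros of `D ∘ ℓ`. -/
def quotientAlong (φ : E → F) (D : ℂ → ℂ) (ℓ : E →L[ℂ] ℂ) (e x : E) : F :=
  open Classical in
  if D (ℓ x) = 0 then (deriv D (ℓ x))⁻¹ • fderiv ℂ φ x e else (D (ℓ x))⁻¹ • φ x

variable {φ : E → F} {D : ℂ → ℂ} {ℓ : E →L[ℂ] ℂ} {e : E}

theorem quotientAlong_of_ne_zero {x : E} (hx : D (ℓ x) ≠ 0) :
    quotientAlong φ D ℓ e x = (D (ℓ x))⁻¹ • φ x :=
  if_neg hx

theorem quotientAlong_eq_inv_smul (he : ℓ e = 1) {m : ℂ} {d : ℂ → ℂ} (hd : Differentiable ℂ d)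
    (hD : ∀ z, D z = (z - m) * d z) {ψ : E → F} (hψ : Differentiable ℂ ψ)
    (hφ : ∀ x, φ x = (ℓ x - m) • ψ x) {x : E} (hx : d (ℓ x) ≠ 0) :
    quotientAlong φ D ℓ e x = (d (ℓ x))⁻¹ • ψ x := by
  rcases eq_or_ne (ℓ x) m with hm | hm
  · have hderivD : deriv D m = d m := by
      have hmul := ((hasDerivAt_id m).sub_const m).fun_mul (hd m).hasDerivAt
      simpa [funext hD] using hmul.deriv
    have hderivφ : fderiv ℂ φ x e = ψ x := by
      have hmul := (ℓ.hasFDerivAt.sub_const m).fun_smul (hψ x).hasFDerivAt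
      rw [funext hφ, hmul.fderiv]
      simp [hm, he]
    rw [quotientAlong, if_pos (by rw [hD, hm, sub_self, zero_mul]), hderivφ, hm, hderivD]
  · rw [← sub_ne_zero] at hm
    rw [quotientAlong_of_ne_zero (by rw [hD]; exact mul_ne_zero hm hx), hφ, hD, mul_inv_rev,
      mul_smul, inv_smul_smul₀ hm]

theorem differentiableAt_quotientAlong_of_eq_zero [ProperSpace E] [CompleteSpace F]
    (hφ : ContDiff ℂ 2 φ) (hD : Differentiable ℂ D) (he : ℓ e = 1)
    (h : ∀ x, D (ℓ x) = 0 → φ x = 0) {x₀ : E} (hx₀ : D (ℓ x₀) = 0)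
    (hD' : deriv D (ℓ x₀) ≠ 0) : DifferentiableAt ℂ (quotientAlong φ D ℓ e) x₀ := by
  obtain ⟨ψ, hψ, hφψ⟩ := exists_eq_sub_smul_of_eq_zero hφ he fun x hx => h x (hx ▸ hx₀)
  set d := dslope D (ℓ x₀)
  have hd : Differentiable ℂ d := by
    rw [← differentiableOn_univ, Complex.differentiableOn_dslope Filter.univ_mem]
    exact hD.differentiableOn
  have hDd (z : ℂ) : D z = (z - ℓ x₀) * d z := by
    rw [← smul_eq_mul, sub_smul_dslope, hx₀, sub_zero]
  have hne : d (ℓ x₀) ≠ 0 := by rwa [← dslope_same] at hD'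
  have hquot : DifferentiableAt ℂ (fun x => (d (ℓ x))⁻¹ • ψ x) x₀ :=
    (((hd _).comp x₀ ℓ.differentiableAt).fun_inv hne).fun_smul (hψ x₀)
  refine hquot.congr_of_eventuallyEq ?_
  filter_upwards [(hd.continuous.comp ℓ.continuous).continuousAt.eventually_ne hne] with x hx
  exact quotientAlong_eq_inv_smul he hd hDd hψ hφψ hx

theorem differentiableAt_quotientAlong_of_ne_zero (hφ : Differentiable ℂ φ)
    (hD : Differentiable ℂ D) {x₀ : E} (hx₀ : D (ℓ x₀) ≠ 0) :
    DifferentiableAt ℂ (quotientAlong φ D ℓ e) x₀ := by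
  have hDℓ : Differentiable ℂ fun x => D (ℓ x) := hD.comp ℓ.differentiable
  refine (((hDℓ x₀).fun_inv hx₀).fun_smul (hφ x₀)).congr_of_eventuallyEq ?_
  filter_upwards [hDℓ.continuous.continuousAt.eventually_ne hx₀] with x hx
  exact quotientAlong_of_ne_zero hx

theorem differentiable_quotientAlong [ProperSpace E] [CompleteSpace F] (hφ : ContDiff ℂ 2 φ)
    (hD : Differentiable ℂ D) (hD' : ∀ z, D z = 0 → deriv D z ≠ 0) (he : ℓ e = 1)
    (h : ∀ x, D (ℓ x) = 0 → φ x = 0) : Differentiable ℂ (quotientAlong φ D ℓ e) := fun x => by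
  by_cases hx : D (ℓ x) = 0
  · exact differentiableAt_quotientAlong_of_eq_zero hφ hD he h hx (hD' _ hx)
  · exact differentiableAt_quotientAlong_of_ne_zero (hφ.differentiable two_ne_zero) hD hx

end Division

/-! ### The zeros of the inverse of the modified dimension -/

theorem hasDerivAt_zeta (r : ℕ) (z : ℂ) :
    HasDerivAt (zeta r) (Real.pi * Complex.I / r * zeta r z) z := by
  refine ((hasDerivAt_id z).const_mul (Real.pi * Complex.I / r)).cexp.congr_deriv ?_
  rw [mul_one, mul_comm]
  rfl

theorem hasDerivAt_qInt (r : ℕ) (z : ℂ) :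
    HasDerivAt (qInt r) (Real.pi * Complex.I / r * (zeta r z + zeta r (-z))) z := by
  refine ((hasDerivAt_zeta r z).sub
    ((hasDerivAt_zeta r (-z)).comp z (hasDerivAt_neg z))).congr_deriv ?_
  ring

theorem differentiable_qInt (r : ℕ) : Differentiable ℂ (qInt r) := fun z =>
  (hasDerivAt_qInt r z).differentiableAt

theorem deriv_qInt_ne_zero {r : ℕ} (hr : r ≠ 0) {z : ℂ} (hz : qInt r z = 0) :
    deriv (qInt r) z ≠ 0 := by
  rw [(hasDerivAt_qInt r z).deriv, ← sub_eq_zero.1 hz, ← two_mul]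
  have hpi : (Real.pi : ℂ) ≠ 0 := Complex.ofReal_ne_zero.2 Real.pi_ne_zero
  have hr' : (r : ℂ) ≠ 0 := Nat.cast_ne_zero.2 hr
  exact mul_ne_zero (div_ne_zero (mul_ne_zero hpi Complex.I_ne_zero) hr')
    (mul_ne_zero two_ne_zero (zeta_ne_zero r z))

theorem deriv_finsetProd_ne_zero {𝕜 ι : Type*} [NontriviallyNormedField 𝕜] {s : Finset ι}
    {d : ι → 𝕜 → 𝕜} {z : 𝕜} (hd : ∀ i ∈ s, DifferentiableAt 𝕜 (d i) z) {j : ι} (hj : j ∈ s)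
    (hzero : d j z = 0) (hderiv : deriv (d j) z ≠ 0) (hne : ∀ i ∈ s, i ≠ j → d i z ≠ 0) :
    deriv (fun z => ∏ i ∈ s, d i z) z ≠ 0 := by
  classical
  rw [deriv_fun_finsetProd hd, Finset.sum_eq_single_of_mem j hj fun i _ hij => ?_]
  · exact smul_ne_zero (Finset.prod_ne_zero_iff.2 fun i hi =>
      hne i (Finset.mem_of_mem_erase hi) (Finset.ne_of_mem_erase hi)) hderiv
  · rw [Finset.prod_eq_zero (Finset.mem_erase.2 ⟨hij.symm, hj⟩) hzero, zero_smul]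

theorem differentiable_modifiedDimInv (r : ℕ) : Differentiable ℂ (modifiedDimInv r) := by
  unfold modifiedDimInv qInt zeta
  fun_prop

theorem deriv_modifiedDimInv_ne_zero {r : ℕ} (hr : r ≠ 0) {z : ℂ} (hz : modifiedDimInv r z = 0) :
    deriv (modifiedDimInv r) z ≠ 0 := by
  obtain ⟨j, hj, hjz⟩ := Finset.prod_eq_zero_iff.1 hz
  have hshift (i : ℕ) (w : ℂ) : HasDerivAt (fun z : ℂ => z + r - i) 1 w :=
    ((hasDerivAt_id w).add_const _).sub_const _
  refine deriv_finsetProd_ne_zero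
    (fun i _ => (differentiable_qInt r _).comp z (hshift i z).differentiableAt) hj hjz ?_
    fun i hi hij hiz => hij ?_
  · have hcomp := (differentiable_qInt r (z + r - j)).hasDerivAt.comp z (hshift j z)
    rw [mul_one] at hcomp
    exact hcomp.deriv.trans_ne (deriv_qInt_ne_zero hr hjz)
  · obtain ⟨k, hk⟩ := (qInt_add_natCast_self_sub_eq_zero_iff hr z j).1 hjz
    obtain ⟨l, hl⟩ := (qInt_add_natCast_self_sub_eq_zero_iff hr z i).1 hiz
    have hdvd : (r : ℤ) ∣ i - j := ⟨k - l, by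
      have : (i - j : ℂ) = r * (k - l) := by linear_combination hk - hl
      exact_mod_cast this⟩
    have := Int.eq_zero_of_abs_lt_dvd hdvd (by grind)
    omega

/-! ### Density of the non-integral colours -/

theorem dense_compl_integers : Dense integersᶜ :=
  (Set.countable_range _).dense_compl ℂ

theorem eq_of_eqOn_not_mem_integers {ι X : Type*} [TopologicalSpace X] [T2Space X]
    {f g : (ι → ℂ) → X} (hf : Continuous f) (hg : Continuous g) (i : ι)
    (h : ∀ α, α i ∉ integers → f α = g α) : f = g :=
  hf.ext_on (dense_compl_integers.preimage (isOpenMap_eval i)) hg h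

theorem not_mem_integers_of_cover_eq {r n : ℕ} {α β : Fin n → ℂ}
    (h : cover r n α = cover r n β) {i : Fin n} (hα : α i ∉ integers) : β i ∉ integers := by
  obtain ⟨m, rfl⟩ := exists_eq_add_two_mul_mul_intCast_of_cover_eq h
  rintro ⟨k, hk⟩
  exact hα ⟨k - 2 * r * m i, by push_cast; linear_combination hk⟩

theorem modifiedDimInv_eq_of_cover_eq {r n : ℕ} (hr : r ≠ 0) {α β : Fin n → ℂ}
    (h : cover r n α = cover r n β) (i : Fin n) :
    modifiedDimInv r (β i) = modifiedDimInv r (α i) := by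
  obtain ⟨m, rfl⟩ := exists_eq_add_two_mul_mul_intCast_of_cover_eq h
  exact modifiedDimInv_add_two_mul_mul_intCast hr (α i) (m i)

theorem Diagram.corner_eq_zero_of_modifiedDimInv_eq_zero {n r : ℕ} [NeZero r] (hr : 2 ≤ r)
    {c i : Fin n} {T : Diagram n [down c] [down c]} {p : ℕ × ℕ} (hp : T.compAt p = some i)
    (hi : i ≠ c) {α : Fin n → ℂ} (hc : modifiedDimInv r (α c) = 0) : T.corner r α = 0 := by
  have hzero : (fun β => T.corner r (Function.update β c (α c))) = fun _ => 0 :=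
    eq_of_eqOn_not_mem_integers ((T.contDiff_corner r 0).continuous.comp (by fun_prop))
      continuous_const i fun β hβ =>
        corner_eq_zero_of_not_mem_integers hr hp (by rwa [Function.update_of_ne hi])
          (by rwa [Function.update_self])
  simpa only [Function.update_eq_self] using congrFun hzero α

/-! ### Quasi-periodic functions and sections -/

/-- Functions on `ℂ^n` which change by the factors of automorphy of the line bundle of `C` between
points over the same point of `(ℂ / 2rℤ)^n`. -/
def IsQuasiPeriodic (r : ℕ) {n : ℕ} (C : Matrix (Fin n) (Fin n) ℤ) (f : (Fin n → ℂ) → ℂ) : Prop :=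
  ∀ ⦃α β⦄, cover r n α = cover r n β → f β = factor r C α β * f α

section

variable {r n : ℕ} {C : Matrix (Fin n) (Fin n) ℤ} {f g : (Fin n → ℂ) → ℂ}

theorem cover_add_two_mul_mul_intCast (α : Fin n → ℂ) (m : Fin n → ℤ) :
    cover r n (fun i => α i + 2 * r * m i) = cover r n α := by
  funext i
  refine (QuotientAddGroup.eq.2 (AddSubgroup.mem_zmultiples_iff.2 ⟨m i, ?_⟩)).symm
  rw [zsmul_eq_mul]
  ring

theorem cover_update_add_two_mul (α : Fin n → ℂ) (i : Fin n) :
    cover r n (Function.update α i (α i + 2 * r)) = cover r n α := by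
  rw [← cover_add_two_mul_mul_intCast α (Pi.single i 1)]
  congr 1
  funext j
  rcases eq_or_ne j i with rfl | hj <;> simp [*]

theorem factor_update_add_two_mul (C : Matrix (Fin n) (Fin n) ℤ) (α : Fin n → ℂ) (i : Fin n) :
    factor r C α (Function.update α i (α i + 2 * r)) = ∏ j, zeta r (2 * r * C i j * α j) := by
  rw [factor, ← zeta_sum, Finset.sum_eq_single_of_mem i (Finset.mem_univ i) fun k _ hk => ?_]
  · simp only [Function.update_self, add_sub_cancel_left]
  · simp only [Function.update_of_ne hk, sub_self, zero_mul, Finset.sum_const_zero]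

theorem IsQuasiPeriodic.of_eqOn_not_mem_integers (hg : IsQuasiPeriodic r C g) (hf : Continuous f)
    (i : Fin n) (h : ∀ α, α i ∉ integers → f α = g α) : IsQuasiPeriodic r C f := fun α β hαβ => by
  obtain ⟨m, rfl⟩ := exists_eq_add_two_mul_mul_intCast_of_cover_eq hαβ
  have hshift : Continuous fun (α : Fin n → ℂ) i => α i + 2 * r * m i := by fun_prop
  have hfactor : Continuous fun α => factor r C α fun i => α i + 2 * r * m i := by
    unfold factor zeta
    fun_prop
  refine congrFun (eq_of_eqOn_not_mem_integers (hf.comp hshift) (hfactor.mul hf) i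
    fun α hα => ?_) α
  have hcover := (cover_add_two_mul_mul_intCast (r := r) α m).symm
  rw [Function.comp_apply, h _ (not_mem_integers_of_cover_eq hcover hα), hg hcover, Pi.mul_apply,
    h α hα]

theorem cover_chart (p : Fin n → ℂ) {x : Base r n} (hx : x ∈ (chart p).source) :
    cover r n (chart p x) = x :=
  (cover_isLocalHomeomorph r n).apply_localInverseAt_of_mem hx

theorem chart_symm (p : Fin n → ℂ) : ⇑(chart (r := r) p).symm = cover r n :=
  (cover_isLocalHomeomorph r n).localInverseAt_symm p

theorem localCoord_eq (C : Matrix (Fin n) (Fin n) ℤ) (s : Base r n → ℂ) (p α : Fin n → ℂ) :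
    localCoord (C := C) s p α =
      factor r C (chart ((lineBundle r C).indexAt (cover r n α)) (cover r n α))
        (chart p (cover r n α)) * s (cover r n α) :=
  rfl

theorem IsQuasiPeriodic.exists_section (hf : IsQuasiPeriodic r C f) :
    ∃ s : ∀ x, (lineBundle r C).Fiber x,
      ∀ p, ∀ α ∈ (chart (r := r) p).target, localCoord s p α = f α := by
  refine ⟨fun x => f (chart ((lineBundle r C).indexAt x) x), fun p α hα => ?_⟩
  have hchart : chart p (cover r n α) = α := by
    rw [← chart_symm p]
    exact (chart p).right_inv hα
  have hcover : cover r n (chart ((lineBundle r C).indexAt (cover r n α)) (cover r n α)) =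
      cover r n α :=
    cover_chart _ ((lineBundle r C).mem_baseSet_at _)
  exact (localCoord_eq C _ p α).trans (by rw [hchart, ← hf hcover])

end

/-! ### The extension of the invariant -/

theorem neg_one_le_meromorphicOrderAt_inv {𝕜 : Type*} [NontriviallyNormedField 𝕜]
    {D : 𝕜 → 𝕜} {z : 𝕜} (hD : AnalyticAt 𝕜 D z) (hD' : D z = 0 → deriv D z ≠ 0) :
    -1 ≤ meromorphicOrderAt D⁻¹ z := by
  rw [meromorphicOrderAt_inv, hD.meromorphicOrderAt_eq]
  by_cases h : D z = 0
  · rw [hD.analyticOrderAt_eq_one_of_zero_deriv_ne_zero h (hD' h)]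
    rfl
  · rw [hD.analyticOrderAt_eq_zero.2 h]
    decide

namespace Diagram

variable {n r : ℕ} [NeZero r] {c : Fin n} (T : Diagram n [down c] [down c])

theorem invariant_eq_inv_mul_corner (hr : 2 ≤ r) {α : Fin n → ℂ} (hα : α c ∉ integers) :
    T.invariant r α = (modifiedDimInv r (α c))⁻¹ * T.corner r α := by
  rw [invariant, T.bracket_eq_corner hr hα, modifiedDim_eq_inv_modifiedDimInv]

theorem isQuasiPeriodic_inv_mul_corner :
    IsQuasiPeriodic r T.linking fun α => (modifiedDimInv r (α c))⁻¹ * T.corner r α :=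
  fun α β h => by
    simp only [modifiedDimInv_eq_of_cover_eq (NeZero.ne r) h, T.corner_eq_factor_mul h,
      mul_left_comm]

theorem differentiable_corner_const : Differentiable ℂ fun z : ℂ => T.corner r fun _ => z :=
  ((T.contDiff_corner r 1).differentiable one_ne_zero).comp (by fun_prop)

theorem neg_one_le_meromorphicOrderAt_inv_mul_corner (z : ℂ) :
    -1 ≤ meromorphicOrderAt (fun z => (modifiedDimInv r z)⁻¹ * T.corner r fun _ => z) z := by
  have hD := (differentiable_modifiedDimInv r).analyticAt z
  have hcorner := (T.differentiable_corner_const (r := r)).analyticAt z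
  change -1 ≤ meromorphicOrderAt ((modifiedDimInv r)⁻¹ * fun z => T.corner r fun _ => z) z
  rw [meromorphicOrderAt_mul hD.meromorphicAt.inv hcorner.meromorphicAt]
  exact le_add_of_le_of_nonneg
    (neg_one_le_meromorphicOrderAt_inv hD (deriv_modifiedDimInv_ne_zero (NeZero.ne r)))
    hcorner.meromorphicOrderAt_nonneg

theorem meromorphic_inv_mul_corner :
    Meromorphic fun z => (modifiedDimInv r z)⁻¹ * T.corner r fun _ => z := fun z =>
  ((differentiable_modifiedDimInv r).analyticAt z).meromorphicAt.fun_inv.fun_mul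
    (T.differentiable_corner_const.analyticAt z).meromorphicAt

theorem analyticAt_inv_mul_corner {z : ℂ} (hz : z ∉ integers) :
    AnalyticAt ℂ (fun z => (modifiedDimInv r z)⁻¹ * T.corner r fun _ => z) z :=
  (((differentiable_modifiedDimInv r).analyticAt z).fun_inv
    (modifiedDimInv_ne_zero (NeZero.ne r) hz)).fun_mul (T.differentiable_corner_const.analyticAt z)

theorem exists_meromorphic_extension (hr : 2 ≤ r) :
    ∃ f : ℂ → ℂ, (∀ z ∉ integers, f z = T.invariant r fun _ => z) ∧ Meromorphic f ∧
      (∀ z ∉ integers, AnalyticAt ℂ f z) ∧ ∀ z, -1 ≤ meromorphicOrderAt f z :=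
  ⟨_, fun z hz => (T.invariant_eq_inv_mul_corner hr (α := fun _ => z) hz).symm,
    T.meromorphic_inv_mul_corner, fun _ => T.analyticAt_inv_mul_corner,
    T.neg_one_le_meromorphicOrderAt_inv_mul_corner⟩

theorem exists_holomorphic_extension (hr : 2 ≤ r)
    (hT : ∃ i ≠ c, ∃ p, T.compAt p = some i) :
    ∃ f : (Fin n → ℂ) → ℂ, Differentiable ℂ f ∧ (∀ α, α c ∉ integers → f α = T.invariant r α) ∧
      IsQuasiPeriodic r T.linking f := by
  obtain ⟨i, hi, p, hp⟩ := hT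
  let proj : (Fin n → ℂ) →L[ℂ] ℂ := .proj c
  let f := quotientAlong (T.corner r) (modifiedDimInv r) proj (Pi.single c 1)
  have hzero (α : Fin n → ℂ) (hα : modifiedDimInv r (proj α) = 0) : T.corner r α = 0 :=
    corner_eq_zero_of_modifiedDimInv_eq_zero hr hp hi hα
  have hf : Differentiable ℂ f := differentiable_quotientAlong (T.contDiff_corner r 2)
    (differentiable_modifiedDimInv r) (fun _ => deriv_modifiedDimInv_ne_zero (NeZero.ne r))
    (Pi.single_eq_same c 1) hzero
  have hf' (α : Fin n → ℂ) (hα : α c ∉ integers) :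
      f α = (modifiedDimInv r (α c))⁻¹ * T.corner r α :=
    quotientAlong_of_ne_zero (modifiedDimInv_ne_zero (NeZero.ne r) hα)
  exact ⟨f, hf, fun α hα => (hf' α hα).trans (T.invariant_eq_inv_mul_corner hr hα).symm,
    T.isQuasiPeriodic_inv_mul_corner.of_eqOn_not_mem_integers hf.continuous c hf'⟩

theorem invariant_update_add_two_mul (hr : 2 ≤ r) {α : Fin n → ℂ} (hα : α c ∉ integers)
    (i : Fin n) : T.invariant r (Function.update α i (α i + 2 * r)) =
      (∏ j, zeta r (2 * r * T.linking i j * α j)) * T.invariant r α := by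
  have hcover := (cover_update_add_two_mul (r := r) α i).symm
  rw [T.invariant_eq_inv_mul_corner hr hα,
    T.invariant_eq_inv_mul_corner hr (not_mem_integers_of_cover_eq hcover hα),
    ← factor_update_add_two_mul]
  exact T.isQuasiPeriodic_inv_mul_corner hcover

theorem exists_quasiPeriodic_extension (hr : 2 ≤ r) :
    ∃ f : (Fin n → ℂ) → ℂ, IsQuasiPeriodic r T.linking f ∧
      (∀ α, α c ∉ integers → f α = T.invariant r α) ∧ (Meromorphic fun z => f fun _ => z) ∧
      ((∃ i ≠ c, ∃ p, T.compAt p = some i) → Differentiable ℂ f) := by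
  by_cases hT : ∃ i ≠ c, ∃ p, T.compAt p = some i
  · obtain ⟨f, hf, hinv, hper⟩ := T.exists_holomorphic_extension hr hT
    have hdiag : Differentiable ℂ fun z : ℂ => f fun _ => z := hf.comp (by fun_prop)
    exact ⟨f, hper, hinv, fun z => (hdiag.analyticAt z).meromorphicAt, fun _ => hf⟩
  · exact ⟨_, T.isQuasiPeriodic_inv_mul_corner,
      fun α hα => (T.invariant_eq_inv_mul_corner hr hα).symm, T.meromorphic_inv_mul_corner,
      fun h => absurd h hT⟩

theorem NumbersComponents.exists_ne {v w : List (Strand n)} {D : Diagram n v w}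
    (hD : D.NumbersComponents) (hn : 1 < n) (i : Fin n) : ∃ j ≠ i, ∃ p, D.compAt p = some j :=
  have : Nontrivial (Fin n) := Fin.nontrivial_iff_two_le.2 hn
  (_root_.exists_ne i).imp fun j hj => ⟨hj, hD.1 j⟩

theorem exists_section (hr : 2 ≤ r) :
    ∃ s : ∀ x, (lineBundle r T.linking).Fiber x,
      (∀ p, ∀ α ∈ (chart (r := r) p).target, α c ∉ integers →
        localCoord s p α = T.invariant r α) ∧
      (∀ p, MeromorphicOn (fun z : ℂ => localCoord s p fun _ => z)
        {z : ℂ | (fun _ => z) ∈ (chart (r := r) p).target}) ∧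
      ((∃ i ≠ c, ∃ x, T.compAt x = some i) →
        ∀ p, DifferentiableOn ℂ (localCoord s p) (chart (r := r) p).target) := by
  obtain ⟨f, hper, hinv, hmer, hdiff⟩ := T.exists_quasiPeriodic_extension hr
  obtain ⟨s, hs⟩ := hper.exists_section
  refine ⟨s, fun p α hp hα => (hs p α hp).trans (hinv α hα), fun p => ?_,
    fun hT p => (hdiff hT).differentiableOn.congr (hs p)⟩
  have hopen : IsOpen {z : ℂ | (fun _ => z) ∈ (chart (r := r) (n := n) p).target} :=
    (chart p).open_target.preimage (continuous_pi fun _ => continuous_id)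
  exact hmer.meromorphicOn.congr (fun z hz => (hs p _ hz).symm) hopen

end Diagram

end ADO

end

theorem mainTheorem6_general (r : ℕ) (hr : 2 ≤ r) (n : ℕ) (c : Fin n)
    (T : ADO.Diagram n [ADO.Strand.down c] [ADO.Strand.down c]) :
    (∀ α : Fin n → ℂ, α c ∉ ADO.integers → T.matrix r α = T.bracket r α • 1) ∧
    (∃ f : ℂ → ℂ,
      (∀ z ∉ ADO.integers, f z = T.invariant r fun _ => z) ∧
      Meromorphic f ∧
      (∀ z ∉ ADO.integers, AnalyticAt ℂ f z) ∧
      ∀ z, -1 ≤ meromorphicOrderAt f z) ∧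
    ((∃ i ≠ c, ∃ x, T.compAt x = some i) → ∃ f : (Fin n → ℂ) → ℂ,
      (∀ α, α c ∉ ADO.integers → f α = T.invariant r α) ∧
      Differentiable ℂ f) ∧
    (∀ α : Fin n → ℂ, α c ∉ ADO.integers → ∀ i,
      T.invariant r (Function.update α i (α i + 2 * r)) =
        (∏ j, ADO.zeta r (2 * r * T.linking i j * α j)) * T.invariant r α) ∧
    (∃ s : ∀ x, (ADO.lineBundle r T.linking).Fiber x,
      (∀ p, ∀ α ∈ (ADO.chart (r := r) p).target, α c ∉ ADO.integers →
        ADO.localCoord s p α = T.invariant r α) ∧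
      (∀ p, MeromorphicOn (fun z : ℂ => ADO.localCoord s p fun _ => z)
        {z : ℂ | (fun _ => z) ∈ (ADO.chart (r := r) p).target}) ∧
      ((∃ i ≠ c, ∃ x, T.compAt x = some i) →
        ∀ p, DifferentiableOn ℂ (ADO.localCoord s p) (ADO.chart (r := r) p).target)) := by
  have : NeZero r := ⟨by omega⟩
  refine ⟨fun α hα => ?_, T.exists_meromorphic_extension hr, fun hT => ?_,
    fun _ hα => T.invariant_update_add_two_mul hr hα, T.exists_section hr⟩
  · rw [T.bracket_eq_corner hr hα]
    exact T.matrix_eq_corner_smul_one hr hα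
  · obtain ⟨f, hf, hinv, -⟩ := T.exists_holomorphic_extension hr hT
    exact ⟨f, hinv, hf⟩

theorem mainTheorem6 (r : ℕ) (hr : 2 ≤ r) (n : ℕ) (c : Fin n)
    (T : ADO.Diagram n [ADO.Strand.down c] [ADO.Strand.down c]) (hT : T.NumbersComponents) :
    -- the scalar `⟨T⟩` in the definition of the invariant exists
    (∀ α : Fin n → ℂ, (∀ i, α i ∉ ADO.integers) → T.matrix r α = T.bracket r α • 1) ∧
    -- knots
    (n = 1 → ∃ f : ℂ → ℂ,
      (∀ z, z ∉ ADO.integers → f z = T.invariant r fun _ => z) ∧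
      Meromorphic f ∧
      (∀ z, z ∉ ADO.integers → AnalyticAt ℂ f z) ∧
      ∀ m : ℤ, -1 ≤ meromorphicOrderAt f (m : ℂ)) ∧
    -- links with more than one component
    (1 < n → ∃ f : (Fin n → ℂ) → ℂ,
      (∀ α, (∀ i, α i ∉ ADO.integers) → f α = T.invariant r α) ∧
      Differentiable ℂ f) ∧
    -- quasi-periodicity
    (∀ α : Fin n → ℂ, (∀ i, α i ∉ ADO.integers) → ∀ i,
      T.invariant r (Function.update α i (α i + 2 * r)) =
        (∏ j, ADO.zeta r (2 * r * T.linking i j * α j)) * T.invariant r α) ∧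
    -- the invariant is a section of a line bundle
    (∃ s : ∀ x, (ADO.lineBundle r T.linking).Fiber x,
      (∀ p, ∀ α ∈ (ADO.chart (r := r) p).target, (∀ i, α i ∉ ADO.integers) →
        ADO.localCoord s p α = T.invariant r α) ∧
      (n = 1 → ∀ p, MeromorphicOn (fun z : ℂ => ADO.localCoord s p fun _ => z)
        {z : ℂ | (fun _ => z) ∈ (ADO.chart (r := r) p).target}) ∧
      (1 < n → ∀ p, DifferentiableOn ℂ (ADO.localCoord s p) (ADO.chart (r := r) p).target)) := by
  obtain ⟨hscalar, ⟨f, hf, hmer, han, hord⟩, hhol, hper, s, hs, hsmer, hshol⟩ :=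
    mainTheorem6_general r hr n c T
  exact ⟨fun α hα => hscalar α (hα c), fun _ => ⟨f, hf, hmer, han, (hord ·)⟩,
    fun hn => (hhol (hT.exists_ne hn c)).imp fun _ => .imp_left fun h α hα => h α (hα c),
    fun α hα => hper α (hα c), s, fun p α hp hα => hs p α hp (hα c), fun _ => hsmer,
    fun hn => hshol (hT.exists_ne hn c)⟩
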